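/- **Model.** An algorithm with oracle access to $f:[M]\to[N]$ has a memory with basis states $|x,p,w\rangle$, $x\in[M]$, $p\in[N]$, $w\in[W]$, started in a basis state. It is a (non-uniform) circuit made of oracle gates $O_f|x,p,w\rangle=e^{2\pi i\,p f(x)/N}|x,p,w\rangle$ and of arbitrary quantum operations on the memory that do not depend on $f$ (including measurement and re-initialisation of qubits). Each such operation may also write a pair of elements of $[M]$ on output qubits, which are never used again. The time $T$ is the number of oracle gates (queries to $f$). The space $S=\lceil\log_2(MNW)\rceil$ is the number of qubits of memory; the output is not counted. A collision of $f$ is a pair $(x_1,x_2)$ with $x_1\ne x_2$ and $f(x_1)=f(x_2)$; two collisions are disjoint if no entry of one is an entry of the other. A run finds $K$ disjoint collisions if all pairs output are collisions (repetitions allowed) and $K$ mutually disjoint ones occur among them. The algorithm finds $K$ disjoint collisions in a random function if it does so with probability at least $2/3$ over a uniformly random $f:[M]\to[N]$ and the computation. An algorithm solves Element Distinctness on domain size $n$ if, for a uniformly random $f:[n]\to[n^2]$, it finds a collision with probability at least $2/3$ conditioned on $f$ having a collision. $\widetilde O,\widetilde\Omega$ hide a constant factor and a power of the logarithm, for all sufficiently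 large sizes. **Statement.** Let $\epsilon\in(0,1)$ and let $\sigma:\mathbb N\to[0,\infty]$ ($\sigma\equiv\infty$ means that the space is not restricted). Suppose that any quantum algorithm that finds $\widetilde\Omega(N)$ disjoint collisions in a random function $f:[10N]\to[N]$ using space $S\le\widetilde O(\sigma(N))$ must satisfy $$T\,S^{1/3}\ \ge\ \widetilde\Omega\big(N^{4/3+\epsilon}\big).$$ (That is, for all $c,a>0$ and $k,l\in\mathbb N$ there are $c'>0$ and $k',N_0\in\mathbb N$ such that for all $N\ge N_0$ every algorithm that finds $K\ge cN/\log^kN$ disjoint collisions in a random $f:[10N]\to[N]$ with $S\le a\,\sigma(N)\log^lN$ has $T S^{1/3}\ge c'N^{4/3+\epsilon}/\log^{k'}N$.) Then any quantum algorithm that solves Element Distinctness on domain size $n$ using space $S\le\widetilde O(\sigma(n^2))$ must satisfy $$T\,S^{1/3}\ \ge\ \widetilde\Omega\big(n^{2/3+2\epsilon}\big).$$ (That is, for all $a>0$ and $l\in\mathbb N$ there are $c'>0$ and $k',n_0\in\mathbb N$ such that for all $n\ge n_0$ every algorithm that solves Element Distinctness on domain size $n$ with $S\le a\,\sigma(n^2)\log^ln$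 has $T S^{1/3}\ge c'n^{2/3+2\epsilon}/\log^{k'}n$.) -/

import Mathlib

open scoped Matrix ENNReal

/-- Basis states `|x, p, w⟩` of the memory of an algorithm that queries `f : [M] → [N]`: a query
register `x ∈ [M]`, a phase register `p ∈ [N]` and a working register `w ∈ [W]`. -/
abbrev MemBasis (M N W : ℕ) : Type := Fin M × Fin N × Fin W

/-- The phase oracle: `O_f |x, p, w⟩ = exp(2πi · p · f(x) / N) |x, p, w⟩`. -/
noncomputable def phaseOracle {M N W : ℕ} (f : Fin M → Fin N) (ψ : MemBasis M N W → ℂ) :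
    MemBasis M N W → ℂ := fun b =>
  Complex.exp (2 * Real.pi * Complex.I * (((b.2.1 : ℕ) * (f b.1 : ℕ) : ℕ) : ℂ) / (N : ℂ)) * ψ b

/-- An input-independent quantum operation on the memory, in Kraus form. It may apply unitaries,
measure, and (re)initialise qubits. When Kraus operator `i` occurs, `out i` is written on fresh
output qubits: either a pair of elements of `[M]`, or nothing. The written value is a label of the
operation and not part of the memory, so it cannot be used later. -/
structure QuantumOp (M N W : ℕ) where
  numKraus : ℕ
  kraus : Fin numKraus → Matrix (MemBasis M N W) (MemBasis M N W) ℂ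
  out : Fin numKraus → Option (Fin M × Fin M)
  complete : ∑ i, (kraus i)ᴴ * kraus i = 1

/-- A gate of a circuit: an oracle gate, or a quantum operation that does not depend on the
input. -/
inductive Gate (M N W : ℕ) : Type where
  | query : Gate M N W
  | op (Q : QuantumOp M N W) : Gate M N W

/-- Whether a gate is an oracle gate. -/
def Gate.isQuery {M N W : ℕ} : Gate M N W → Bool
  | .query => true
  | .op _ => false

/-- A space-bounded quantum circuit with oracle access to a function `f : [M] → [N]`. -/
structure QCircuit (M N : ℕ) where
  /-- dimension of the working register -/
  W : ℕ
  /-- the basis state in which the memory starts -/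
  init : MemBasis M N W
  gates : List (Gate M N W)

namespace QCircuit

/-- The time `T`: the number of queries to the input function. -/
def time {M N : ℕ} (C : QCircuit M N) : ℕ := C.gates.countP Gate.isQuery

/-- The space `S`: the number of qubits that hold the memory, that is `⌈log₂ (M · N · W)⌉`.
The output is not counted. -/
def space {M N : ℕ} (C : QCircuit M N) : ℕ := Nat.clog 2 (M * N * C.W)

open Classical in
/-- Probability that a list of gates on input `f`, started in the (unnormalised) state `ψ` with
the pairs in `z` already output, ends with a list of output pairs that satisfies `accept`. The
branch of Kraus operator `i` has the unnormalised state `Kᵢ ψ`, and a branch that ends in the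
state `ψ` has probability `‖ψ‖²`. -/
noncomputable def runProb {M N W : ℕ} (f : Fin M → Fin N)
    (accept : List (Fin M × Fin M) → Prop) :
    List (Gate M N W) → (MemBasis M N W → ℂ) → List (Fin M × Fin M) → ℝ
  | [], ψ, z => if accept z then ∑ b, ‖ψ b‖ ^ 2 else 0
  | .query :: gs, ψ, z => runProb f accept gs (phaseOracle f ψ) z
  | .op Q :: gs, ψ, z =>
      ∑ i, runProb f accept gs (Q.kraus i *ᵥ ψ) (z ++ (Q.out i).toList)

/-- Probability that the list of all pairs output by the circuit on input `f` satisfies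
`accept`. -/
noncomputable def outputProb {M N : ℕ} (C : QCircuit M N) (f : Fin M → Fin N)
    (accept : List (Fin M × Fin M) → Prop) : ℝ :=
  runProb f accept C.gates (Pi.single C.init 1) []

end QCircuit

/-- `(x₁, x₂)` is a collision of `f`. -/
def IsCollision {M N : ℕ} (f : Fin M → Fin N) (p : Fin M × Fin M) : Prop :=
  p.1 ≠ p.2 ∧ f p.1 = f p.2

/-- Two collisions `(x₁, x₂)` and `(x₃, x₄)` are disjoint if no entry of one is an entry of the
other. -/
def DisjointPairs {M : ℕ} (p q : Fin M × Fin M) : Prop :=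
  p.1 ≠ q.1 ∧ p.1 ≠ q.2 ∧ p.2 ≠ q.1 ∧ p.2 ≠ q.2

/-- The output list `z` is correct for the task of finding `K` disjoint collisions of `f`: every
output pair is a collision (repetitions are allowed), and `K` mutually disjoint collisions occur
among them. -/
def FoundDisjointCollisions {M N : ℕ} (K : ℕ) (f : Fin M → Fin N)
    (z : List (Fin M × Fin M)) : Prop :=
  (∀ p ∈ z, IsCollision f p) ∧
    ∃ D : Finset (Fin M × Fin M), (∀ p ∈ D, p ∈ z) ∧ K ≤ D.card ∧
      ∀ p ∈ D, ∀ q ∈ D, p ≠ q → DisjointPairs p q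

/-- The circuit finds `K` disjoint collisions in a uniformly random `f : [M] → [N]` with
probability at least `2/3` (over `f` and the computation). -/
def FindsDisjointCollisions {M N : ℕ} (C : QCircuit M N) (K : ℕ) : Prop :=
  2 / 3 ≤ (∑ f : Fin M → Fin N, C.outputProb f (FoundDisjointCollisions K f)) /
    (Fintype.card (Fin M → Fin N) : ℝ)

open Classical in
/-- The circuit solves Element Distinctness on domain size `n`: it finds a collision in a uniformly
random `f : [n] → [n²]`, with success probability at least `2/3` conditioned on the event that
`f` has a collision at all. -/
def SolvesElementDistinctness {n : ℕ} (C : QCircuit n (n ^ 2)) : Prop :=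
  2 / 3 * ((Finset.univ.filter fun f : Fin n → Fin (n ^ 2) => ¬ Function.Injective f).card : ℝ) ≤
    ∑ f ∈ Finset.univ.filter fun f : Fin n → Fin (n ^ 2) => ¬ Function.Injective f,
      C.outputProb f (FoundDisjointCollisions 1 f)

/-- `S ≤ a · σ · (log N)^l`; there is no restriction when `σ = ∞`, `a > 0` and `N ≥ 2`. -/
def SpaceWithin (a : ℝ) (l N : ℕ) (σ : ℝ≥0∞) (S : ℕ) : Prop :=
  (S : ℝ≥0∞) ≤ ENNReal.ofReal (a * Real.log N ^ l) * σ

/-- Any quantum algorithm that finds `Ω̃(N)` disjoint collisions in a random function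
`f : [10N] → [N]` using space `S ≤ Õ(σ(N))` satisfies `T · S^{1/3} ≥ Ω̃(N^{4/3 + ε})`.
`Õ` and `Ω̃` hide a constant factor and a power of `log N`; the factor hidden in the conclusion
depends only on those hidden in the assumptions. -/
def CollisionTradeoff (ε : ℝ) (σ : ℕ → ℝ≥0∞) : Prop :=
  ∀ c : ℝ, 0 < c → ∀ k : ℕ, ∀ a : ℝ, 0 < a → ∀ l : ℕ,
    ∃ c' : ℝ, 0 < c' ∧ ∃ k' N₀ : ℕ, ∀ N : ℕ, N₀ ≤ N →
      ∀ K : ℕ, c * (N : ℝ) / Real.log N ^ k ≤ (K : ℝ) →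
        ∀ C : QCircuit (10 * N) N, SpaceWithin a l N (σ N) C.space →
          FindsDisjointCollisions C K →
            c' * (N : ℝ) ^ (4 / 3 + ε) / Real.log N ^ k' ≤
              (C.time : ℝ) * (C.space : ℝ) ^ (1 / 3 : ℝ)

/-- Any quantum algorithm that solves Element Distinctness on domain size `n` using space
`S ≤ Õ(σ(n))` satisfies `T · S^{1/3} ≥ Ω̃(n^{2/3 + 2ε})`. -/
def ElementDistinctnessTradeoff (ε : ℝ) (σ : ℕ → ℝ≥0∞) : Prop :=
  ∀ a : ℝ, 0 < a → ∀ l : ℕ,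
    ∃ c' : ℝ, 0 < c' ∧ ∃ k' n₀ : ℕ, ∀ n : ℕ, n₀ ≤ n →
      ∀ C : QCircuit n (n ^ 2), SpaceWithin a l n (σ n) C.space →
        SolvesElementDistinctness C →
          c' * (n : ℝ) ^ (2 / 3 + 2 * ε) / Real.log n ^ k' ≤
            (C.time : ℝ) * (C.space : ℝ) ^ (1 / 3 : ℝ)

/-! By the birthday bound a random map [n] → [n²] has a collision with probability at least 1/5, so
an Element Distinctness algorithm finds one on a uniform input with probability at least 2/15. Given
a random f : [10n²] → [n²], run the algorithm on the restrictions of f to Θ(n²) sets of size n, one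
after the other in the same memory. This costs O(n²T) queries and O(S) qubits. With N = n², dividing
N^(4/3+ε) = n^(8/3+2ε) by n² gives the claimed bound.

So many sets of size n must overlap. They are lines t ↦ (t, αt + β) in [n] × ℤ/p with p a prime, n <
p ≤ 2n, and α < A = ⌊n/1000⌋; two distinct lines share at most one point (`line_inter`). This is
used twice.

Concentration: a shift c i is added to the values of f on line i, which does not change its
collisions. Over random f and c, the shift hides the single shared value, so the inputs are uniform
and pairwise independent (`exists_shift`, `sum_mul_blocks_eq_zero`). A second-moment argument then
bounds the number of successes from below (`sum_sq_blocks_le`, `le_blocksExp`). Averaging yields one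
fixed c, which is built into the circuit.

Disjointness: collisions on two lines can meet only if three distinct points have the same value.
The expected fraction of lines on which this happens is at most A/n
(`sum_card_crowdedBlocks_mul_le`), and Markov's inequality applies.

One wrong output pair spoils the whole run. Therefore the simulation stores the last pair in memory
instead of outputting it, and two further queries test it without error (`runExp_verify`). The extra
queries are absorbed because an algorithm that makes no query cannot succeed (`time_pos_of_solves`).
-/

/-- The squared Euclidean norm of an unnormalised state. -/
noncomputable def sqNorm {ι : Type*} [Fintype ι] (ψ : ι → ℂ) : ℝ := ∑ b, ‖ψ b‖ ^ 2

/-! ### Norms of unnormalised states -/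

section SqNorm

variable {ι κ : Type*} [Fintype ι] [Fintype κ]

lemma sqNorm_nonneg (ψ : ι → ℂ) : 0 ≤ sqNorm ψ := Finset.sum_nonneg fun _ _ => by positivity

lemma sqNorm_smul (a : ℂ) (ψ : ι → ℂ) : sqNorm (a • ψ) = ‖a‖ ^ 2 * sqNorm ψ := by
  simp [sqNorm, Finset.mul_sum, mul_pow]

lemma sqNorm_single [DecidableEq ι] (b : ι) : sqNorm (Pi.single b (1 : ℂ)) = 1 := by
  unfold sqNorm
  rw [Finset.sum_eq_single b]
  · simp
  · intro c _ hc
    simp [Pi.single_eq_of_ne hc]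
  · simp

lemma ofReal_sqNorm (ψ : ι → ℂ) : ((sqNorm ψ : ℝ) : ℂ) = star ψ ⬝ᵥ ψ := by
  simp only [sqNorm, dotProduct, Pi.star_apply, RCLike.star_def, Complex.ofReal_sum,
    Complex.ofReal_pow]
  exact Finset.sum_congr rfl fun b _ => by rw [mul_comm, Complex.mul_conj']

lemma sum_sqNorm_mulVec [DecidableEq ι] (A : κ → Matrix ι ι ℂ)
    (hA : ∑ i, (A i)ᴴ * A i = 1) (ψ : ι → ℂ) : ∑ i, sqNorm (A i *ᵥ ψ) = sqNorm ψ := by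
  apply Complex.ofReal_injective
  rw [Complex.ofReal_sum]
  simp only [ofReal_sqNorm, Matrix.star_mulVec, ← Matrix.dotProduct_mulVec, Matrix.mulVec_mulVec]
  rw [← dotProduct_sum, ← Matrix.sum_mulVec, hA, Matrix.one_mulVec]

end SqNorm

/-! ### Expectations over runs of a circuit -/

namespace QCircuit

variable {M N W : ℕ}

lemma phaseOracle_smul (f : Fin M → Fin N) (a : ℂ) (ψ : MemBasis M N W → ℂ) :
    phaseOracle f (a • ψ) = a • phaseOracle f ψ := by
  ext b
  simp only [phaseOracle, Pi.smul_apply, smul_eq_mul]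
  ring

lemma norm_exp_phase (k N : ℕ) : ‖Complex.exp (2 * Real.pi * Complex.I * (k : ℂ) / (N : ℂ))‖ = 1 := by
  have : 2 * Real.pi * Complex.I * (k : ℂ) / (N : ℂ)
      = ((2 * Real.pi * k / N : ℝ) : ℂ) * Complex.I := by
    push_cast
    ring
  rw [this, Complex.norm_exp_ofReal_mul_I]

lemma sqNorm_phaseOracle (f : Fin M → Fin N) (ψ : MemBasis M N W → ℂ) :
    sqNorm (phaseOracle f ψ) = sqNorm ψ := by
  unfold sqNorm phaseOracle
  refine Finset.sum_congr rfl fun b _ => ?_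
  rw [norm_mul, norm_exp_phase, one_mul]

/-- The expectation of `F` at the list of output pairs, for a list of gates started in the
unnormalised state `ψ` with the pairs in `z` already output. -/
noncomputable def runExp (f : Fin M → Fin N) (F : List (Fin M × Fin M) → ℝ) :
    List (Gate M N W) → (MemBasis M N W → ℂ) → List (Fin M × Fin M) → ℝ
  | [], ψ, z => F z * sqNorm ψ
  | .query :: gs, ψ, z => runExp f F gs (phaseOracle f ψ) z
  | .op Q :: gs, ψ, z => ∑ i, runExp f F gs (Q.kraus i *ᵥ ψ) (z ++ (Q.out i).toList)

open Classical in
lemma runProb_eq_runExp (f : Fin M → Fin N) (accept : List (Fin M × Fin M) → Prop)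
    (gs : List (Gate M N W)) (ψ : MemBasis M N W → ℂ) (z : List (Fin M × Fin M)) :
    runProb f accept gs ψ z = runExp f (fun z => if accept z then 1 else 0) gs ψ z := by
  induction gs generalizing ψ z with
  | nil => simp [runProb, runExp, sqNorm]
  | cons g gs ih =>
    cases g with
    | query => exact ih _ _
    | op Q => exact Finset.sum_congr rfl fun i _ => ih _ _

lemma runExp_smul (f : Fin M → Fin N) (F : List (Fin M × Fin M) → ℝ)
    (gs : List (Gate M N W)) (a : ℂ) (ψ : MemBasis M N W → ℂ) (z : List (Fin M × Fin M)) :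
    runExp f F gs (a • ψ) z = ‖a‖ ^ 2 * runExp f F gs ψ z := by
  induction gs generalizing ψ z with
  | nil => simp only [runExp, sqNorm_smul]; ring
  | cons g gs ih =>
    cases g with
    | query => simp only [runExp, phaseOracle_smul, ih]
    | op Q => simp only [runExp, Matrix.mulVec_smul, ih, Finset.mul_sum]

lemma runExp_zero (f : Fin M → Fin N) (F : List (Fin M × Fin M) → ℝ)
    (gs : List (Gate M N W)) (z : List (Fin M × Fin M)) : runExp f F gs 0 z = 0 := by
  simpa using runExp_smul f F gs 0 0 z

/-- A tail that sees the state only through its norm amounts to a change of test function, so stages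
compose without tracking the state. -/
lemma runExp_append (f : Fin M → Fin N) (F H : List (Fin M × Fin M) → ℝ)
    (gs hs : List (Gate M N W)) (hH : ∀ ψ z, runExp f F hs ψ z = H z * sqNorm ψ)
    (ψ : MemBasis M N W → ℂ) (z : List (Fin M × Fin M)) :
    runExp f F (gs ++ hs) ψ z = runExp f H gs ψ z := by
  induction gs generalizing ψ z with
  | nil => exact hH _ _
  | cons g gs ih =>
    cases g with
    | query => exact ih _ _
    | op Q => exact Finset.sum_congr rfl fun i _ => ih _ _

lemma runExp_mono (f : Fin M → Fin N) {F G : List (Fin M × Fin M) → ℝ} (h : ∀ z, F z ≤ G z)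
    (gs : List (Gate M N W)) (ψ : MemBasis M N W → ℂ) (z : List (Fin M × Fin M)) :
    runExp f F gs ψ z ≤ runExp f G gs ψ z := by
  induction gs generalizing ψ z with
  | nil => exact mul_le_mul_of_nonneg_right (h z) (sqNorm_nonneg ψ)
  | cons g gs ih =>
    cases g with
    | query => exact ih _ _
    | op Q => exact Finset.sum_le_sum fun i _ => ih _ _

lemma runExp_linear (f : Fin M → Fin N) (F G : List (Fin M × Fin M) → ℝ) (a b : ℝ)
    (gs : List (Gate M N W)) (ψ : MemBasis M N W → ℂ) (z : List (Fin M × Fin M)) :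
    runExp f (fun z => a * F z + b * G z) gs ψ z
      = a * runExp f F gs ψ z + b * runExp f G gs ψ z := by
  induction gs generalizing ψ z with
  | nil => simp only [runExp]; ring
  | cons g gs ih =>
    cases g with
    | query => exact ih _ _
    | op Q => simp only [runExp, ih, Finset.sum_add_distrib, Finset.mul_sum]

lemma runExp_const (f : Fin M → Fin N) (r : ℝ)
    (gs : List (Gate M N W)) (ψ : MemBasis M N W → ℂ) (z : List (Fin M × Fin M)) :
    runExp f (fun _ => r) gs ψ z = r * sqNorm ψ := by
  induction gs generalizing ψ z with
  | nil => rfl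
  | cons g gs ih =>
    cases g with
    | query => simp only [runExp, ih, sqNorm_phaseOracle]
    | op Q => simp only [runExp, ih, ← Finset.mul_sum, sum_sqNorm_mulVec _ Q.complete]

/-! ### Constructing quantum operations -/

/-- A quantum operation whose Kraus operators are indexed by an arbitrary finite type. -/
noncomputable def _root_.QuantumOp.ofFamily {κ : Type*} [Fintype κ]
    (A : κ → Matrix (MemBasis M N W) (MemBasis M N W) ℂ) (out : κ → Option (Fin M × Fin M))
    (hA : ∑ k, (A k)ᴴ * A k = 1) : QuantumOp M N W where
  numKraus := Fintype.card κ
  kraus i := A ((Fintype.equivFin κ).symm i)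
  out i := out ((Fintype.equivFin κ).symm i)
  complete := by rw [← hA, Equiv.sum_comp (Fintype.equivFin κ).symm fun k => (A k)ᴴ * A k]

lemma runExp_ofFamily {κ : Type*} [Fintype κ]
    (A : κ → Matrix (MemBasis M N W) (MemBasis M N W) ℂ) (out : κ → Option (Fin M × Fin M))
    (hA : ∑ k, (A k)ᴴ * A k = 1) (f : Fin M → Fin N) (F : List (Fin M × Fin M) → ℝ)
    (gs : List (Gate M N W)) (ψ : MemBasis M N W → ℂ) (z : List (Fin M × Fin M)) :
    runExp f F (.op (.ofFamily A out hA) :: gs) ψ z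
      = ∑ k, runExp f F gs (A k *ᵥ ψ) (z ++ (out k).toList) :=
  Equiv.sum_comp (Fintype.equivFin κ).symm
    fun k => runExp f F gs (A k *ᵥ ψ) (z ++ (out k).toList)

/-- The sum P of the products is Hermitian and idempotent, hence (1 - P)ᴴ(1 - P) = 1 - P fills the
gap. -/
lemma complete_option {κ ι : Type*} [Fintype κ] [Fintype ι] [DecidableEq ι]
    (A : κ → Matrix ι ι ℂ) (hs : (∑ k, (A k)ᴴ * A k) * (∑ k, (A k)ᴴ * A k) = ∑ k, (A k)ᴴ * A k) :
    ∑ k : Option κ, (k.elim (1 - ∑ k, (A k)ᴴ * A k) A)ᴴ *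
      k.elim (1 - ∑ k, (A k)ᴴ * A k) A = 1 := by
  have hh : (∑ k, (A k)ᴴ * A k)ᴴ = ∑ k, (A k)ᴴ * A k := by
    simp [Matrix.conjTranspose_sum]
  rw [Fintype.sum_option]
  simp only [Option.elim, Matrix.conjTranspose_sub, Matrix.conjTranspose_one, hh]
  rw [sub_mul, mul_sub, mul_sub, hs]
  simp

/-- The quantum operation with the given Kraus operators, which sum up to a projection, completed
by the complementary projection, which outputs nothing. -/
noncomputable def _root_.QuantumOp.ofProjection {κ : Type*} [Fintype κ]
    (A : κ → Matrix (MemBasis M N W) (MemBasis M N W) ℂ) (out : κ → Option (Fin M × Fin M))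
    (hs : (∑ k, (A k)ᴴ * A k) * (∑ k, (A k)ᴴ * A k) = ∑ k, (A k)ᴴ * A k) : QuantumOp M N W :=
  .ofFamily (fun k : Option κ => k.elim (1 - ∑ k, (A k)ᴴ * A k) A) (fun k => k.elim none out)
    (complete_option A hs)

lemma runExp_ofProjection {κ : Type*} [Fintype κ]
    (A : κ → Matrix (MemBasis M N W) (MemBasis M N W) ℂ) (out : κ → Option (Fin M × Fin M))
    (hs : (∑ k, (A k)ᴴ * A k) * (∑ k, (A k)ᴴ * A k) = ∑ k, (A k)ᴴ * A k)
    (f : Fin M → Fin N) (F : List (Fin M × Fin M) → ℝ)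
    (gs : List (Gate M N W)) (ψ : MemBasis M N W → ℂ) (z : List (Fin M × Fin M)) :
    runExp f F (.op (.ofProjection A out hs) :: gs) ψ z
      = runExp f F gs (ψ - (∑ k, (A k)ᴴ * A k) *ᵥ ψ) z
        + ∑ k, runExp f F gs (A k *ᵥ ψ) (z ++ (out k).toList) := by
  rw [QuantumOp.ofProjection, runExp_ofFamily, Fintype.sum_option]
  simp [Matrix.sub_mulVec]

lemma sqNorm_sub_projection {κ ι : Type*} [Fintype κ] [Fintype ι] [DecidableEq ι]
    (A : κ → Matrix ι ι ℂ) (hs : (∑ k, (A k)ᴴ * A k) * (∑ k, (A k)ᴴ * A k) = ∑ k, (A k)ᴴ * A k)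
    (ψ : ι → ℂ) :
    sqNorm (ψ - (∑ k, (A k)ᴴ * A k) *ᵥ ψ) = sqNorm ψ - ∑ k, sqNorm (A k *ᵥ ψ) := by
  have := sum_sqNorm_mulVec _ (complete_option A hs) ψ
  rw [Fintype.sum_option] at this
  simp only [Option.elim, Matrix.sub_mulVec, Matrix.one_mulVec] at this
  linarith

/-- The Kraus operator `|v⟩⟨b|`. -/
def ketBra {ι : Type*} [DecidableEq ι] (v : ι → ℂ) (b : ι) : Matrix ι ι ℂ :=
  Matrix.vecMulVec v (Pi.single b 1)

lemma ketBra_mulVec {ι : Type*} [Fintype ι] [DecidableEq ι] (v : ι → ℂ) (b : ι) (ψ : ι → ℂ) :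
    ketBra v b *ᵥ ψ = ψ b • v := by
  simp [ketBra, Matrix.vecMulVec_mulVec]

lemma sum_ketBra {ι : Type*} [Fintype ι] [DecidableEq ι] (v : ι → ι → ℂ)
    (hv : ∀ b, sqNorm (v b) = 1) : ∑ b, (ketBra (v b) b)ᴴ * ketBra (v b) b = 1 := by
  have h : ∀ b, (ketBra (v b) b)ᴴ * ketBra (v b) b = Matrix.diagonal (Pi.single b (1 : ℂ)) := by
    intro b
    have : star (v b) ⬝ᵥ v b = 1 := by rw [← ofReal_sqNorm, hv, Complex.ofReal_one]
    rw [ketBra, Matrix.conjTranspose_vecMulVec, Matrix.vecMulVec_mul_vecMulVec, this]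
    ext i j
    by_cases hi : i = b <;> by_cases hj : j = b <;> by_cases hij : i = j <;>
      simp_all [Matrix.vecMulVec_apply]
  simp only [h]
  ext i j
  simp [Matrix.sum_apply, Matrix.diagonal_apply, Matrix.one_apply, Pi.single_apply]

/-- Measure the memory in the computational basis and prepare the state `v b` on outcome `b`. -/
noncomputable def _root_.QuantumOp.prepare (v : MemBasis M N W → MemBasis M N W → ℂ)
    (hv : ∀ b, sqNorm (v b) = 1) : QuantumOp M N W :=
  .ofFamily (fun b => ketBra (v b) b) (fun _ => none) (sum_ketBra v hv)

lemma runExp_prepare (v : MemBasis M N W → MemBasis M N W → ℂ) (hv : ∀ b, sqNorm (v b) = 1)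
    (f : Fin M → Fin N) (F : List (Fin M × Fin M) → ℝ)
    (gs : List (Gate M N W)) (ψ : MemBasis M N W → ℂ) (z : List (Fin M × Fin M)) :
    runExp f F (.op (.prepare v hv) :: gs) ψ z
      = ∑ b, ‖ψ b‖ ^ 2 * runExp f F gs (v b) z := by
  rw [QuantumOp.prepare, runExp_ofFamily]
  simp [ketBra_mulVec, runExp_smul]

/-- Apply a single isometry. -/
noncomputable def _root_.QuantumOp.ofUnitary
    (U : Matrix (MemBasis M N W) (MemBasis M N W) ℂ) (hU : Uᴴ * U = 1) : QuantumOp M N W :=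
  .ofFamily (fun _ : Unit => U) (fun _ => none) (by simpa using hU)

lemma runExp_ofUnitary (U : Matrix (MemBasis M N W) (MemBasis M N W) ℂ) (hU : Uᴴ * U = 1)
    (f : Fin M → Fin N) (F : List (Fin M × Fin M) → ℝ)
    (gs : List (Gate M N W)) (ψ : MemBasis M N W → ℂ) (z : List (Fin M × Fin M)) :
    runExp f F (.op (.ofUnitary U hU) :: gs) ψ z = runExp f F gs (U *ᵥ ψ) z := by
  rw [QuantumOp.ofUnitary, runExp_ofFamily]
  simp

end QCircuit

/-! ### Simulating a small circuit in a larger memory -/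

namespace QCircuit

section Simulation

variable {M N n W W' : ℕ}

/-- The basis state of the large memory that represents the basis state `b` of the simulated
memory, when `o` is the last pair that the simulated circuit has output. -/
def embed (φ : Fin n → Fin M) (enc : Fin n × Fin W × Option (Fin n × Fin n) ≃ Fin W')
    (o : Option (Fin n × Fin n)) (b : MemBasis n N W) : MemBasis M N W' :=
  (φ b.1, b.2.1, enc (b.1, b.2.2, o))

/-- No injectivity of `φ` is needed: `enc` keeps a copy of the small query register. -/
lemma embed_inj (φ : Fin n → Fin M) (enc : Fin n × Fin W × Option (Fin n × Fin n) ≃ Fin W')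
    {o o' : Option (Fin n × Fin n)} {b b' : MemBasis n N W} :
    embed φ enc o b = embed φ enc o' b' ↔ o = o' ∧ b = b' := by
  obtain ⟨x, p, w⟩ := b
  obtain ⟨x', p', w'⟩ := b'
  simp only [embed, Prod.mk.injEq, EmbeddingLike.apply_eq_iff_eq]
  constructor
  · rintro ⟨-, rfl, rfl, rfl, rfl⟩
    simp
  · rintro ⟨rfl, rfl, rfl, rfl⟩
    simp

/-- The isometry that embeds the simulated memory. -/
def lift (N : ℕ) (φ : Fin n → Fin M) (enc : Fin n × Fin W × Option (Fin n × Fin n) ≃ Fin W')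
    (o : Option (Fin n × Fin n)) : Matrix (MemBasis M N W') (MemBasis n N W) ℂ :=
  Matrix.of fun B b => if B = embed φ enc o b then 1 else 0

variable (φ : Fin n → Fin M) (enc : Fin n × Fin W × Option (Fin n × Fin n) ≃ Fin W')

lemma lift_conjTranspose_mul_lift (o o' : Option (Fin n × Fin n)) :
    (lift N φ enc o : Matrix (MemBasis M N W') (MemBasis n N W) ℂ)ᴴ * lift N φ enc o'
      = if o = o' then 1 else 0 := by
  ext b b'
  simp only [lift, Matrix.mul_apply, Matrix.conjTranspose_apply, Matrix.of_apply]
  rw [Finset.sum_eq_single (embed φ enc o b)]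
  · by_cases ho : o = o' <;> by_cases hb : b = b' <;>
      simp [embed_inj, ho, hb, Matrix.one_apply]
  · intro B _ hB
    simp [hB]
  · simp

lemma sum_lift_mulVec (o : Option (Fin n × Fin n)) (ψ : MemBasis n N W → ℂ)
    (B : MemBasis M N W') :
    (lift N φ enc o *ᵥ ψ) B = ∑ b, if B = embed φ enc o b then ψ b else 0 := by
  simp [lift, Matrix.mulVec, dotProduct]

lemma lift_mulVec_embed (o : Option (Fin n × Fin n)) (ψ : MemBasis n N W → ℂ)
    (b : MemBasis n N W) : (lift N φ enc o *ᵥ ψ) (embed φ enc o b) = ψ b := by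
  rw [sum_lift_mulVec, Finset.sum_eq_single b]
  · simp
  · intro b' _ hb
    rw [if_neg]
    rw [embed_inj]
    tauto
  · simp

lemma lift_mulVec_of_ne (o : Option (Fin n × Fin n)) (ψ : MemBasis n N W → ℂ)
    (B : MemBasis M N W') (hB : ∀ b, B ≠ embed φ enc o b) : (lift N φ enc o *ᵥ ψ) B = 0 := by
  rw [sum_lift_mulVec]
  exact Finset.sum_eq_zero fun b _ => if_neg (hB b)

lemma lift_mulVec_single (o : Option (Fin n × Fin n)) (b : MemBasis n N W) :
    lift N φ enc o *ᵥ Pi.single b 1 = Pi.single (embed φ enc o b : MemBasis M N W') 1 := by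
  ext B
  simp [lift, Pi.single_apply]

lemma sum_norm_lift_mulVec (o : Option (Fin n × Fin n)) (ψ : MemBasis n N W → ℂ)
    (H : MemBasis M N W' → ℝ) :
    ∑ B, ‖(lift N φ enc o *ᵥ ψ) B‖ ^ 2 * H B = ∑ b, ‖ψ b‖ ^ 2 * H (embed φ enc o b) := by
  symm
  rw [← Finset.sum_subset (Finset.subset_univ (Finset.univ.image (embed φ enc o))),
    Finset.sum_image]
  · exact Finset.sum_congr rfl fun b _ => by rw [lift_mulVec_embed]
  · intro b _ b' _ h
    exact ((embed_inj φ enc).1 h).2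
  · intro B _ hB
    rw [lift_mulVec_of_ne]
    · simp
    · rintro b rfl
      simp at hB

/-- The last output pair after a gate that may output a pair. -/
def lastPair (o q : Option (Fin n × Fin n)) : Option (Fin n × Fin n) := q.or o

/-- The Kraus operators that simulate `Q` and record its output in the memory. -/
noncomputable def liftKraus (Q : QuantumOp n N W)
    (k : Fin Q.numKraus × Option (Fin n × Fin n)) :
    Matrix (MemBasis M N W') (MemBasis M N W') ℂ :=
  lift N φ enc (lastPair k.2 (Q.out k.1)) * Q.kraus k.1 * (lift N φ enc k.2)ᴴ

/-- Completeness of `Q` cancels the middle factor. What remains is the projection onto the span of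
the embedded states, independent of `Q`. -/
lemma sum_liftKraus (Q : QuantumOp n N W) :
    ∑ k, (liftKraus φ enc Q k)ᴴ * liftKraus φ enc Q k
      = ∑ o, lift N φ enc o * (lift N φ enc o : Matrix (MemBasis M N W') (MemBasis n N W) ℂ)ᴴ := by
  rw [Fintype.sum_prod_type_right]
  refine Finset.sum_congr rfl fun o _ => ?_
  have h : ∀ i, (liftKraus φ enc Q (i, o))ᴴ * liftKraus φ enc Q (i, o)
      = lift N φ enc o * ((Q.kraus i)ᴴ * Q.kraus i) *
        (lift N φ enc o : Matrix (MemBasis M N W') (MemBasis n N W) ℂ)ᴴ := by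
    intro i
    simp only [liftKraus, Matrix.conjTranspose_mul, Matrix.conjTranspose_conjTranspose,
      Matrix.mul_assoc]
    rw [← Matrix.mul_assoc (lift N φ enc (lastPair o (Q.out i)))ᴴ, lift_conjTranspose_mul_lift,
      if_pos rfl, Matrix.one_mul]
  simp only [h]
  rw [← Matrix.sum_mul, ← Matrix.mul_sum, Q.complete, Matrix.mul_one]

lemma sum_lift_mul_lift (o : Option (Fin n × Fin n)) :
    (∑ o, lift N φ enc o * (lift N φ enc o : Matrix (MemBasis M N W') (MemBasis n N W) ℂ)ᴴ)
      * lift N φ enc o = lift N φ enc o := by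
  rw [Matrix.sum_mul]
  simp only [Matrix.mul_assoc, lift_conjTranspose_mul_lift]
  rw [Finset.sum_eq_single o]
  · simp
  · intro o' _ ho
    simp [ho]
  · simp

/-- The simulation of a quantum operation. -/
noncomputable def liftOp (Q : QuantumOp n N W) : QuantumOp M N W' :=
  .ofProjection (liftKraus φ enc Q) (fun _ => none) (by
    rw [sum_liftKraus]
    conv_lhs => rw [Matrix.mul_sum]
    refine Finset.sum_congr rfl fun o _ => ?_
    rw [← Matrix.mul_assoc, sum_lift_mul_lift])

lemma runExp_liftOp (Q : QuantumOp n N W) (f : Fin M → Fin N) (F : List (Fin M × Fin M) → ℝ)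
    (gs : List (Gate M N W')) (o : Option (Fin n × Fin n)) (ψ : MemBasis n N W → ℂ)
    (z : List (Fin M × Fin M)) :
    runExp f F (.op (liftOp φ enc Q) :: gs) (lift N φ enc o *ᵥ ψ) z
      = ∑ i, runExp f F gs (lift N φ enc (lastPair o (Q.out i)) *ᵥ (Q.kraus i *ᵥ ψ)) z := by
  rw [liftOp, runExp_ofProjection, sum_liftKraus, Matrix.mulVec_mulVec, sum_lift_mul_lift,
    sub_self, runExp_zero, zero_add, Fintype.sum_prod_type]
  refine Finset.sum_congr rfl fun i _ => ?_
  rw [Finset.sum_eq_single o]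
  · simp only [liftKraus, Matrix.mulVec_mulVec, Option.toList_none, List.append_nil]
    rw [Matrix.mul_assoc, lift_conjTranspose_mul_lift, if_pos rfl, Matrix.mul_one]
  · intro o' _ ho
    simp only [liftKraus, Matrix.mulVec_mulVec, Option.toList_none, List.append_nil]
    rw [Matrix.mul_assoc, lift_conjTranspose_mul_lift, if_neg ho, Matrix.mul_zero,
      Matrix.zero_mulVec, runExp_zero]
  · simp

/-- The phase `exp(2πi k / N)`. -/
noncomputable def phase (N k : ℕ) : ℂ :=
  Complex.exp (2 * Real.pi * Complex.I * (k : ℂ) / (N : ℂ))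

lemma phase_add (N k l : ℕ) : phase N (k + l) = phase N k * phase N l := by
  rw [phase, phase, phase, ← Complex.exp_add]
  congr 1
  push_cast
  ring

lemma phase_mul_self (N k : ℕ) [NeZero N] : phase N (N * k) = 1 := by
  rw [phase, Complex.exp_eq_one_iff]
  refine ⟨k, ?_⟩
  have : (N : ℂ) ≠ 0 := Nat.cast_ne_zero.2 (NeZero.ne N)
  push_cast
  field_simp

lemma phase_congr {N k l : ℕ} [NeZero N] (h : k ≡ l [MOD N]) : phase N k = phase N l := by
  rw [← Nat.div_add_mod k N, ← Nat.div_add_mod l N, h, phase_add, phase_add, phase_mul_self,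
    phase_mul_self]

lemma norm_phase (N k : ℕ) : ‖phase N k‖ = 1 := norm_exp_phase k N

lemma phaseOracle_apply (f : Fin M → Fin N) (ψ : MemBasis M N W → ℂ) (b : MemBasis M N W) :
    phaseOracle f ψ b = phase N (b.2.1 * f b.1) * ψ b := rfl

/-- The unitary that turns queries to `f` into queries to `f + c`. -/
noncomputable def shiftMatrix (c : Fin N) : Matrix (MemBasis M N W') (MemBasis M N W') ℂ :=
  Matrix.diagonal fun B => phase N (B.2.1 * c)

lemma shiftMatrix_unitary (c : Fin N) :
    (shiftMatrix c : Matrix (MemBasis M N W') (MemBasis M N W') ℂ)ᴴ * shiftMatrix c = 1 := by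
  rw [shiftMatrix, Matrix.diagonal_conjTranspose, Matrix.diagonal_mul_diagonal,
    ← Matrix.diagonal_one]
  congr 1
  ext B
  simp only [Pi.star_apply, RCLike.star_def]
  rw [mul_comm, Complex.mul_conj', norm_phase]
  simp

/-- The diagonal phase adds p·c to the exponent p·f(x), and only residues mod N matter. -/
lemma shift_query_lift [NeZero N] (c : Fin N) (f : Fin M → Fin N) (o : Option (Fin n × Fin n))
    (ψ : MemBasis n N W → ℂ) :
    shiftMatrix c *ᵥ phaseOracle f (lift N φ enc o *ᵥ ψ)
      = lift N φ enc o *ᵥ phaseOracle (fun x => f (φ x) + c) ψ := by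
  ext B
  rw [shiftMatrix, Matrix.mulVec_diagonal, phaseOracle_apply]
  by_cases hB : ∃ b, B = embed φ enc o b
  · obtain ⟨b, rfl⟩ := hB
    rw [lift_mulVec_embed, lift_mulVec_embed, phaseOracle_apply, ← mul_assoc, ← phase_add]
    congr 1
    apply phase_congr
    simp only [embed, Fin.val_add]
    rw [← mul_add, add_comm]
    exact (Nat.mod_modEq _ _).symm.mul_left _
  · push Not at hB
    rw [lift_mulVec_of_ne _ _ _ _ _ hB, lift_mulVec_of_ne _ _ _ _ _ hB]
    simp

/-- The simulation of a list of gates on the function `f ∘ φ + c`. -/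
noncomputable def simulate (c : Fin N) : List (Gate n N W) → List (Gate M N W')
  | [] => []
  | .query :: gs => .query :: .op (.ofUnitary (shiftMatrix c) (shiftMatrix_unitary c)) ::
      simulate c gs
  | .op Q :: gs => .op (liftOp φ enc Q) :: simulate c gs

/-- The simulation itself outputs nothing, so `z` stays fixed; the tail learns about the simulated
list `y` only through its last entry, held in memory. -/
lemma runExp_simulate [NeZero N] (c : Fin N) (f : Fin M → Fin N) (F : List (Fin M × Fin M) → ℝ)
    (tail : List (Gate M N W')) (G : Option (Fin n × Fin n) → ℝ) (z : List (Fin M × Fin M))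
    (hG : ∀ o (ψ : MemBasis n N W → ℂ),
      runExp f F tail (lift N φ enc o *ᵥ ψ) z = G o * sqNorm ψ)
    (gs : List (Gate n N W)) (ψ : MemBasis n N W → ℂ) (y : List (Fin n × Fin n)) :
    runExp f F (simulate φ enc c gs ++ tail) (lift N φ enc y.getLast? *ᵥ ψ) z
      = runExp (fun x => f (φ x) + c) (fun y => G y.getLast?) gs ψ y := by
  induction gs generalizing ψ y with
  | nil => exact hG _ _
  | cons g gs ih =>
    cases g with
    | query =>
      simp only [simulate, List.cons_append]
      rw [runExp, runExp_ofUnitary, shift_query_lift, ih, runExp]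
    | op Q =>
      simp only [simulate, List.cons_append]
      rw [runExp_liftOp, runExp]
      refine Finset.sum_congr rfl fun i _ => ?_
      rw [← ih]
      congr 3
      rw [List.getLast?_append, lastPair]
      cases Q.out i <;> simp

lemma countP_simulate (c : Fin N) (gs : List (Gate n N W)) :
    (simulate φ enc c gs).countP Gate.isQuery = gs.countP Gate.isQuery := by
  induction gs with
  | nil => rfl
  | cons g gs ih =>
    cases g with
    | query =>
      simp only [simulate, List.countP_cons, ih]
      rfl
    | op Q =>
      simp only [simulate, List.countP_cons, ih]
      rfl

end Simulation

end QCircuit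

/-! ### Testing f(x) = f(y) without error -/

namespace QCircuit

section Verification

lemma phase_sum {N : ℕ} [NeZero N] {k : ℕ} (hk : ¬ N ∣ k) : ∑ p : Fin N, phase N (p * k) = 0 := by
  have hpow : ∀ p : ℕ, phase N (p * k) = phase N k ^ p := by
    intro p
    induction p with
    | zero => simp [phase]
    | succ p ih => rw [Nat.add_mul, one_mul, phase_add, ih, pow_succ]
  have h1 : phase N k ≠ 1 := by
    intro h
    rw [phase, Complex.exp_eq_one_iff] at h
    obtain ⟨m, hm⟩ := h
    apply hk
    have hN : (N : ℂ) ≠ 0 := Nat.cast_ne_zero.2 (NeZero.ne N)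
    have hpi : (2 * Real.pi * Complex.I : ℂ) ≠ 0 := Complex.two_pi_I_ne_zero
    have : (k : ℂ) = N * m := by
      rw [div_eq_iff hN] at hm
      apply mul_left_cancel₀ hpi
      rw [hm]
      ring
    have h2 : (k : ℤ) = N * m := by exact_mod_cast this
    exact Int.natCast_dvd_natCast.1 ⟨m, h2⟩
  simp only [hpow]
  rw [Fin.sum_univ_eq_sum_range (fun p => phase N k ^ p), geom_sum_eq h1, ← hpow, phase_mul_self]
  simp

/-- Orthogonality of the characters of ℤ/N, since the summand is the phase of p(b - a). -/
lemma phase_mul_neg_sum {N : ℕ} [NeZero N] (a b : Fin N) :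
    ∑ p : Fin N, phase N (p * b) * phase N ((-p : Fin N) * a) = if a = b then (N : ℂ) else 0 := by
  have hneg : ∀ p : Fin N, (((-p : Fin N) : ℕ) : ZMod N) = - ((p : ℕ) : ZMod N) := by
    intro p
    have h := congrArg Fin.val (neg_add_cancel p)
    rw [Fin.val_add, Fin.val_zero] at h
    have : ((((-p : Fin N) : ℕ) + (p : ℕ) : ℕ) : ZMod N) = 0 := by
      rw [ZMod.natCast_eq_zero_iff]
      exact Nat.dvd_of_mod_eq_zero h
    push_cast at this
    exact eq_neg_of_add_eq_zero_left this
  have hsub : (((b - a : Fin N) : ℕ) : ZMod N) = ((b : ℕ) : ZMod N) - ((a : ℕ) : ZMod N) := by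
    have h := congrArg Fin.val (sub_add_cancel b a)
    rw [Fin.val_add] at h
    have : ((((b - a : Fin N) : ℕ) + (a : ℕ) : ℕ) : ZMod N) = ((b : ℕ) : ZMod N) := by
      rw [ZMod.natCast_eq_natCast_iff', h, Nat.mod_eq_of_lt b.2]
    push_cast at this
    exact eq_sub_of_add_eq this
  have key : ∀ p : Fin N, phase N (p * b) * phase N ((-p : Fin N) * a)
      = phase N (p * (b - a : Fin N)) := by
    intro p
    rw [← phase_add]
    apply phase_congr
    rw [← ZMod.natCast_eq_natCast_iff]
    push_cast
    rw [hneg, hsub]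
    ring
  simp only [key]
  split_ifs with h
  · subst h
    simp [phase]
  · apply phase_sum
    intro hd
    have h0 := Nat.eq_zero_of_dvd_of_lt hd (b - a).2
    apply h
    have : b - a = 0 := Fin.ext h0
    exact (sub_eq_zero.1 this).symm

variable {M N W' : ℕ}

/-- The state `|x⟩ ⊗ θ ⊗ |w⟩`. -/
def fiberState (x : Fin M) (w : Fin W') (θ : Fin N → ℂ) : MemBasis M N W' → ℂ :=
  fun B => if B.1 = x ∧ B.2.2 = w then θ B.2.1 else 0

lemma dotProduct_fiberState (x x' : Fin M) (w w' : Fin W') (η θ : Fin N → ℂ) :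
    star (fiberState x w η) ⬝ᵥ fiberState x' w' θ
      = if x = x' ∧ w = w' then star η ⬝ᵥ θ else 0 := by
  simp only [dotProduct, Fintype.sum_prod_type]
  rw [Finset.sum_eq_single x]
  · have : ∀ p : Fin N, ∑ v : Fin W', star (fiberState x w η) (x, p, v) *
        fiberState x' w' θ (x, p, v) = if x = x' ∧ w = w' then star η p * θ p else 0 := by
      intro p
      rw [Finset.sum_eq_single w]
      · simp [fiberState]
      · intro v _ hv
        simp [fiberState, hv]
      · simp
    simp only [this]
    split_ifs <;> simp
  · intro y _ hy
    simp [fiberState, hy]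
  · simp

lemma sqNorm_fiberState (x : Fin M) (w : Fin W') (θ : Fin N → ℂ) :
    sqNorm (fiberState x w θ) = sqNorm θ := by
  apply Complex.ofReal_injective
  rw [ofReal_sqNorm, dotProduct_fiberState, if_pos ⟨rfl, rfl⟩, ofReal_sqNorm]

lemma phaseOracle_fiberState (f : Fin M → Fin N) (x : Fin M) (w : Fin W') (θ : Fin N → ℂ) :
    phaseOracle f (fiberState x w θ) = fiberState x w fun p => phase N (p * f x) * θ p := by
  ext B
  rw [phaseOracle_apply, fiberState, fiberState]
  split_ifs with h
  · rw [h.1]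
  · simp

/-- The uniform superposition. -/
noncomputable def uniform (N : ℕ) : Fin N → ℂ := fun _ => ((Real.sqrt N)⁻¹ : ℝ)

lemma sqNorm_uniform (N : ℕ) [NeZero N] : sqNorm (uniform N) = 1 := by
  have : (N : ℝ) ≠ 0 := Nat.cast_ne_zero.2 (NeZero.ne N)
  simp [sqNorm, uniform, this]

section Measure

variable {κ : Type*} [Fintype κ] [DecidableEq κ]

lemma sum_rankOne {ι : Type*} [Fintype ι] (v : κ → ι → ℂ)
    (hv : ∀ j k, star (v j) ⬝ᵥ v k = if j = k then 1 else 0) :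
    (∑ k, (Matrix.vecMulVec (v k) (star (v k)))ᴴ * Matrix.vecMulVec (v k) (star (v k))) *
      (∑ k, (Matrix.vecMulVec (v k) (star (v k)))ᴴ * Matrix.vecMulVec (v k) (star (v k)))
      = ∑ k, (Matrix.vecMulVec (v k) (star (v k)))ᴴ * Matrix.vecMulVec (v k) (star (v k)) := by
  have h : ∀ k, (Matrix.vecMulVec (v k) (star (v k)))ᴴ * Matrix.vecMulVec (v k) (star (v k))
      = Matrix.vecMulVec (v k) (star (v k)) := by
    intro k
    rw [Matrix.conjTranspose_vecMulVec, star_star, Matrix.vecMulVec_mul_vecMulVec, hv]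
    simp
  simp only [h]
  rw [Matrix.sum_mul]
  refine Finset.sum_congr rfl fun k _ => ?_
  rw [Matrix.mul_sum, Finset.sum_eq_single k]
  · rw [Matrix.vecMulVec_mul_vecMulVec, hv]
    simp
  · intro j _ hj
    rw [Matrix.vecMulVec_mul_vecMulVec, hv, if_neg (Ne.symm hj)]
    simp
  · simp

/-- Measure whether the memory is in one of the orthonormal states `v k`, and output `out k` if it
is in `v k`. -/
noncomputable def _root_.QuantumOp.measure (v : κ → MemBasis M N W' → ℂ)
    (hv : ∀ j k, star (v j) ⬝ᵥ v k = if j = k then 1 else 0)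
    (out : κ → Option (Fin M × Fin M)) : QuantumOp M N W' :=
  .ofProjection (fun k => Matrix.vecMulVec (v k) (star (v k))) out (sum_rankOne v hv)

lemma runExp_measure (v : κ → MemBasis M N W' → ℂ)
    (hv : ∀ j k, star (v j) ⬝ᵥ v k = if j = k then 1 else 0)
    (out : κ → Option (Fin M × Fin M)) (f : Fin M → Fin N) (F : List (Fin M × Fin M) → ℝ)
    (ψ : MemBasis M N W' → ℂ) (z : List (Fin M × Fin M)) :
    runExp f F [.op (.measure v hv out)] ψ z
      = F z * (sqNorm ψ - ∑ k, ‖star (v k) ⬝ᵥ ψ‖ ^ 2)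
        + ∑ k, F (z ++ (out k).toList) * ‖star (v k) ⬝ᵥ ψ‖ ^ 2 := by
  have h1 : ∀ k, sqNorm (v k) = 1 := fun k => by
    apply Complex.ofReal_injective
    rw [ofReal_sqNorm, hv, if_pos rfl, Complex.ofReal_one]
  have h2 : ∀ k, sqNorm (Matrix.vecMulVec (v k) (star (v k)) *ᵥ ψ)
      = ‖star (v k) ⬝ᵥ ψ‖ ^ 2 := by
    intro k
    rw [Matrix.vecMulVec_mulVec, op_smul_eq_smul, sqNorm_smul, h1, mul_one]
  rw [QuantumOp.measure, runExp_ofProjection]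
  simp only [runExp]
  rw [sqNorm_sub_projection _ (sum_rankOne v hv)]
  simp only [h2]

end Measure

variable (src dst : Fin W' → Fin M)

/-- Exchange `src w` and `dst w` in the query register and negate the phase register. -/
def flipBasis [NeZero N] (B : MemBasis M N W') : MemBasis M N W' :=
  (Equiv.swap (src B.2.2) (dst B.2.2) B.1, -B.2.1, B.2.2)

lemma flipBasis_flipBasis [NeZero N] (B : MemBasis M N W') :
    flipBasis src dst (flipBasis src dst B) = B := by
  simp [flipBasis]

/-- The permutation matrix of `flipBasis`. -/
def flipMatrix [NeZero N] : Matrix (MemBasis M N W') (MemBasis M N W') ℂ :=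
  Matrix.of fun B B' => if B' = flipBasis src dst B then 1 else 0

lemma flipMatrix_mulVec [NeZero N] (ψ : MemBasis M N W' → ℂ) (B : MemBasis M N W') :
    (flipMatrix src dst *ᵥ ψ) B = ψ (flipBasis src dst B) := by
  simp [flipMatrix, Matrix.mulVec, dotProduct]

lemma flipMatrix_unitary [NeZero N] :
    (flipMatrix src dst : Matrix (MemBasis M N W') (MemBasis M N W') ℂ)ᴴ * flipMatrix src dst
      = 1 := by
  ext B B'
  simp only [flipMatrix, Matrix.mul_apply, Matrix.conjTranspose_apply, Matrix.of_apply]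
  rw [Finset.sum_eq_single (flipBasis src dst B)]
  · by_cases h : B = B'
    · subst h
      simp [flipBasis_flipBasis]
    · simp [flipBasis_flipBasis, h, Ne.symm h]
  · intro C _ hC
    rw [if_neg]
    · simp
    · rintro rfl
      rw [flipBasis_flipBasis] at hC
      exact hC rfl
  · simp

lemma flipMatrix_fiberState [NeZero N] (w : Fin W') (θ : Fin N → ℂ) :
    flipMatrix src dst *ᵥ fiberState (src w) w θ = fiberState (dst w) w fun p => θ (-p) := by
  ext B
  rw [flipMatrix_mulVec]
  obtain ⟨x, p, v⟩ := B
  simp only [fiberState, flipBasis]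
  by_cases hv : v = w
  · subst hv
    have : Equiv.swap (src v) (dst v) x = src v ↔ x = dst v := by
      rw [← Equiv.eq_symm_apply]
      simp
    simp [this]
  · simp [hv]

lemma orthonormal_uniform [NeZero N] (j k : Fin M × Fin W') :
    star (fiberState j.1 j.2 (uniform N)) ⬝ᵥ fiberState k.1 k.2 (uniform N)
      = if j = k then 1 else 0 := by
  rw [dotProduct_fiberState, ← ofReal_sqNorm, sqNorm_uniform, Complex.ofReal_one]
  simp only [Prod.ext_iff]

/-- The gates that verify with two queries whether the two points recorded in the working register
have the same image, and output a pair if they do. -/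
noncomputable def verify [NeZero N] (out : Fin W' → Option (Fin M × Fin M)) :
    List (Gate M N W') :=
  [.op (.prepare (fun B => fiberState (src B.2.2) B.2.2 (uniform N))
      (fun _ => by rw [sqNorm_fiberState, sqNorm_uniform])),
    .query, .op (.ofUnitary (flipMatrix src dst) (flipMatrix_unitary src dst)), .query,
    .op (.measure (fun k : Fin M × Fin W' => fiberState k.1 k.2 (uniform N)) orthonormal_uniform
      fun k => out k.2)]

/-- The two queries, with the sign of p flipped in between, turn the uniform phase register into the
character p ↦ p(f(dst) - f(src)) up to normalisation. It equals the uniform state if the values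
agree and is orthogonal to it otherwise. -/
lemma runExp_verify [NeZero N] (out : Fin W' → Option (Fin M × Fin M)) (f : Fin M → Fin N)
    (F : List (Fin M × Fin M) → ℝ) (ψ : MemBasis M N W' → ℂ) (z : List (Fin M × Fin M)) :
    runExp f F (verify src dst out) ψ z
      = ∑ B, ‖ψ B‖ ^ 2 *
        F (z ++ if f (src B.2.2) = f (dst B.2.2) then (out B.2.2).toList else []) := by
  rw [verify, runExp_prepare]
  refine Finset.sum_congr rfl fun B _ => ?_
  generalize B.2.2 = w
  congr 1
  rw [runExp, phaseOracle_fiberState, runExp_ofUnitary, flipMatrix_fiberState, runExp,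
    phaseOracle_fiberState, runExp_measure]
  have hN : (N : ℂ) ≠ 0 := Nat.cast_ne_zero.2 (NeZero.ne N)
  have hdot : star (uniform N) ⬝ᵥ (fun p => phase N (p * f (dst w)) *
      (phase N ((-p : Fin N) * f (src w)) * uniform N (-p)))
      = if f (src w) = f (dst w) then 1 else 0 := by
    have hs : ((Real.sqrt N)⁻¹ : ℂ) * ((Real.sqrt N)⁻¹ : ℂ) = (N : ℂ)⁻¹ := by
      rw [← mul_inv, ← Complex.ofReal_mul, Real.mul_self_sqrt (Nat.cast_nonneg N)]
      simp
    have h := phase_mul_neg_sum (f (src w)) (f (dst w))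
    have h2 : ∀ p : Fin N, star (uniform N) p * (phase N (p * f (dst w)) *
        (phase N ((-p : Fin N) * f (src w)) * uniform N (-p)))
        = (N : ℂ)⁻¹ * (phase N (p * f (dst w)) * phase N ((-p : Fin N) * f (src w))) := by
      intro p
      simp only [uniform, Pi.star_apply, RCLike.star_def, Complex.conj_ofReal]
      rw [Complex.ofReal_inv]
      rw [← hs]
      ring
    rw [dotProduct]
    simp only [h2]
    rw [← Finset.mul_sum, h]
    split_ifs <;> simp [hN]
  have hnorm : sqNorm (fun p : Fin N => phase N (p * f (dst w)) *
      (phase N ((-p : Fin N) * f (src w)) * uniform N (-p))) = 1 := by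
    rw [← sqNorm_uniform N]
    unfold sqNorm
    refine Finset.sum_congr rfl fun p _ => ?_
    simp [norm_phase, uniform]
  simp only [dotProduct_fiberState, hdot, sqNorm_fiberState, hnorm]
  rw [Finset.sum_eq_single (dst w, w), Finset.sum_eq_single (dst w, w)]
  · by_cases h : f (src w) = f (dst w) <;> simp [h]
  · rintro ⟨x, v⟩ _ hne
    rw [if_neg]
    · simp
    · simpa [Prod.ext_iff] using hne
  · simp
  · rintro ⟨x, v⟩ _ hne
    rw [if_neg]
    · simp
    · simpa [Prod.ext_iff] using hne
  · simp

end Verification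

end QCircuit

/-! ### Blocks: run, verify, output -/

namespace QCircuit

section Blocks

variable {M N n W' : ℕ}

/-- The pair `o`, if it is a collision of `g`. -/
def verified (g : Fin n → Fin N) (o : Option (Fin n × Fin n)) : Option (Fin n × Fin n) :=
  o.filter fun q => decide (q.1 ≠ q.2 ∧ g q.1 = g q.2)

lemma verified_eq_some {g : Fin n → Fin N} {o : Option (Fin n × Fin n)} {q : Fin n × Fin n} :
    verified g o = some q ↔ o = some q ∧ IsCollision g q := by
  simp [verified, Option.filter_eq_some_iff, IsCollision]

/-- The expectation of `G` at the list of output pairs of `C` on input `g`. -/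
noncomputable def outputExp (C : QCircuit n N) (g : Fin n → Fin N)
    (G : List (Fin n × Fin n) → ℝ) : ℝ :=
  runExp g G C.gates (Pi.single C.init 1) []

/-- The probability that the last output pair of `C` on input `g` is a collision. -/
noncomputable def successProb (C : QCircuit n N) (g : Fin n → Fin N) : ℝ :=
  outputExp C g fun y => if (verified g y.getLast?).isSome then 1 else 0

lemma outputExp_mono (C : QCircuit n N) (g : Fin n → Fin N) {F G : List (Fin n × Fin n) → ℝ}
    (h : ∀ y, F y ≤ G y) : outputExp C g F ≤ outputExp C g G := runExp_mono g h _ _ _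

lemma outputExp_const (C : QCircuit n N) (g : Fin n → Fin N) (r : ℝ) :
    outputExp C g (fun _ => r) = r := by
  rw [outputExp, runExp_const, sqNorm_single, mul_one]

lemma successProb_nonneg (C : QCircuit n N) (g : Fin n → Fin N) : 0 ≤ successProb C g := by
  rw [← outputExp_const C g 0]
  exact outputExp_mono C g fun y => by split_ifs <;> simp

lemma successProb_le_one (C : QCircuit n N) (g : Fin n → Fin N) : successProb C g ≤ 1 := by
  conv_rhs => rw [← outputExp_const C g 1]
  exact outputExp_mono C g fun y => by split_ifs <;> simp

/-- A correct list is nonempty and consists of collisions, so its last entry is one. Hence it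
suffices to remember a single pair. -/
lemma outputProb_le_successProb (C : QCircuit n N) (g : Fin n → Fin N) :
    C.outputProb g (FoundDisjointCollisions 1 g) ≤ successProb C g := by
  classical
  rw [outputProb, runProb_eq_runExp]
  refine outputExp_mono C g fun y => ?_
  split_ifs with h1 h2 h2
  · exact le_rfl
  · exfalso
    apply h2
    obtain ⟨hy, D, hD, hcard, -⟩ := h1
    obtain ⟨p, hp⟩ := Finset.card_pos.1 hcard
    have hne : y ≠ [] := List.ne_nil_of_mem (hD p hp)
    rw [Option.isSome_iff_exists]
    exact ⟨y.getLast hne, verified_eq_some.2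
      ⟨List.getLast?_eq_some_getLast hne, hy _ (List.getLast_mem hne)⟩⟩
  · exact zero_le_one
  · exact le_rfl

/-- The points of the large domain that are compared when the working register is `w`. -/
def comparedPoints {W : ℕ} (φ : Fin n → Fin M)
    (enc : Fin n × Fin W × Option (Fin n × Fin n) ≃ Fin W') (w : Fin W') : Fin M × Fin M :=
  (enc.symm w).2.2.elim (φ (enc.symm w).1, φ (enc.symm w).1) (Prod.map φ φ)

/-- The pair that is output if the comparison succeeds when the working register is `w`. -/
def candidate {W : ℕ} (φ : Fin n → Fin M)
    (enc : Fin n × Fin W × Option (Fin n × Fin n) ≃ Fin W') (w : Fin W') :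
    Option (Fin M × Fin M) :=
  ((enc.symm w).2.2.filter fun q => decide (q.1 ≠ q.2)).map (Prod.map φ φ)

/-- The gates that run `C` on the input `f ∘ φ + c`, verify the last pair that it outputs, and
output that pair if it is a collision. -/
noncomputable def block [NeZero N] (C : QCircuit n N) (φ : Fin n → Fin M)
    (enc : Fin n × Fin C.W × Option (Fin n × Fin n) ≃ Fin W') (c : Fin N) :
    List (Gate M N W') :=
  .op (.prepare (fun _ => Pi.single (embed φ enc none C.init) 1) fun _ => sqNorm_single _) ::
    (simulate φ enc c C.gates ++ verify (fun w => (comparedPoints φ enc w).1)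
      (fun w => (comparedPoints φ enc w).2) (candidate φ enc))

lemma countP_block [NeZero N] (C : QCircuit n N) (φ : Fin n → Fin M)
    (enc : Fin n × Fin C.W × Option (Fin n × Fin n) ≃ Fin W') (c : Fin N) :
    (block C φ enc c).countP Gate.isQuery = C.time + 2 := by
  rw [block, List.countP_cons, List.countP_append, countP_simulate]
  rfl

/-- The initial preparation resets the memory, so only the norm of the incoming state survives; this
makes blocks independent for fixed `f`. -/
lemma runExp_block [NeZero N] (C : QCircuit n N) (φ : Fin n → Fin M)
    (enc : Fin n × Fin C.W × Option (Fin n × Fin n) ≃ Fin W') (c : Fin N) (f : Fin M → Fin N)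
    (F : List (Fin M × Fin M) → ℝ) (ψ : MemBasis M N W' → ℂ) (z : List (Fin M × Fin M)) :
    runExp f F (block C φ enc c) ψ z
      = outputExp C (fun x => f (φ x) + c) (fun y => F (z ++
          ((verified (fun x => f (φ x) + c) y.getLast?).map (Prod.map φ φ)).toList)) * sqNorm ψ := by
  rw [block, runExp_prepare, ← Finset.sum_mul, mul_comm]
  congr 1
  rw [← lift_mulVec_single]
  refine runExp_simulate φ enc c f F _
    (fun o => F (z ++ ((verified (fun x => f (φ x) + c) o).map (Prod.map φ φ)).toList)) z
    (fun o ψ => ?_) C.gates (Pi.single C.init 1) []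
  rw [runExp_verify, sum_norm_lift_mulVec φ enc o ψ (fun B => F (z ++
    if f (comparedPoints φ enc B.2.2).1 = f (comparedPoints φ enc B.2.2).2 then
      (candidate φ enc B.2.2).toList else [])), sqNorm, Finset.mul_sum]
  refine Finset.sum_congr rfl fun b _ => ?_
  rw [mul_comm]
  congr 3
  cases o with
  -- Without a stored pair a point is compared with itself: the test passes, but there is no
  -- candidate to output.
  | none => simp [embed, comparedPoints, candidate, verified]
  | some q =>
    by_cases h1 : q.1 = q.2 <;> by_cases h2 : f (φ q.1) = f (φ q.2) <;>
      simp [embed, comparedPoints, candidate, verified, Option.filter, h1, h2]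

variable {ι : Type*}

/-- The expectation of `F` at the list of output pairs, for a sequence of blocks with the pairs in
`z` already output. -/
noncomputable def blocksExp (C : QCircuit n N) (φ : ι → Fin n → Fin M) (c : ι → Fin N)
    (f : Fin M → Fin N) (F : List (Fin M × Fin M) → ℝ) :
    List ι → List (Fin M × Fin M) → ℝ
  | [], z => F z
  | i :: L, z => outputExp C (fun x => f (φ i x) + c i) fun y => blocksExp C φ c f F L
      (z ++ ((verified (fun x => f (φ i x) + c i) y.getLast?).map (Prod.map (φ i) (φ i))).toList)

lemma runExp_blocks [NeZero N] (C : QCircuit n N) (φ : ι → Fin n → Fin M)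
    (enc : Fin n × Fin C.W × Option (Fin n × Fin n) ≃ Fin W') (c : ι → Fin N)
    (f : Fin M → Fin N) (F : List (Fin M × Fin M) → ℝ) (L : List ι)
    (ψ : MemBasis M N W' → ℂ) (z : List (Fin M × Fin M)) :
    runExp f F (L.flatMap fun i => block C (φ i) enc (c i)) ψ z
      = blocksExp C φ c f F L z * sqNorm ψ := by
  induction L generalizing ψ z with
  | nil => rfl
  | cons i L ih =>
    rw [List.flatMap_cons, runExp_append f F (blocksExp C φ c f F L) _ _ ih, runExp_block]
    rfl

/-- `p` is a collision of `f` inside the block `i`. -/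
def BlockCollision (φ : ι → Fin n → Fin M) (f : Fin M → Fin N) (i : ι) (p : Fin M × Fin M) :
    Prop :=
  ∃ x y, x ≠ y ∧ f (φ i x) = f (φ i y) ∧ p = (φ i x, φ i y)

/-- For fixed `f` the number of successes is a sum of independent Bernoulli variables, so its second
moment about μ is the squared bias plus a variance of at most one per block. -/
lemma le_blocksExp (C : QCircuit n N) (φ : ι → Fin n → Fin M) (c : ι → Fin N)
    (f : Fin M → Fin N) (F : List (Fin M × Fin M) → ℝ) (μ κ : ℝ) (hκ : 0 ≤ κ) (L : List ι)
    (z : List (Fin M × Fin M))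
    (hF : ∀ I z', I.Sublist L → List.Forall₂ (BlockCollision φ f) I z' →
      1 - κ * ((z ++ z').length - μ) ^ 2 ≤ F (z ++ z')) :
    1 - κ * ((z.length + (L.map fun i => successProb C fun x => f (φ i x) + c i).sum - μ) ^ 2
      + L.length) ≤ blocksExp C φ c f F L z := by
  induction L generalizing z with
  | nil => simpa [blocksExp] using hF [] [] (List.Sublist.refl _) List.Forall₂.nil
  | cons i L ih =>
    set g : Fin n → Fin N := fun x => f (φ i x) + c i with hg
    set s := successProb C g with hs
    set a := z.length + (L.map fun i => successProb C fun x => f (φ i x) + c i).sum - μ with ha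
    have hs0 : 0 ≤ s := successProb_nonneg C g
    have hs1 : s ≤ 1 := successProb_le_one C g
    -- The inductive bound is affine in the success indicator: a success replaces a by a + 1, and (a
    -- + 1)² - a² = 2a + 1.
    have hstep : outputExp C g (fun y => (1 - κ * (a ^ 2 + L.length)) * 1 + (- κ * (2 * a + 1)) *
        (if (verified g y.getLast?).isSome then 1 else 0)) ≤ blocksExp C φ c f F (i :: L) z := by
      rw [blocksExp]
      refine outputExp_mono C g fun y => ?_
      cases hv : verified g y.getLast? with
      | none =>
        simp only [Option.map_none, Option.toList_none, List.append_nil, Option.isSome_none]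
        have := ih z fun I z' hI hz' => hF I z' (hI.cons i) hz'
        simpa using this
      | some q =>
        simp only [Option.map_some, Option.toList_some, Option.isSome_some, if_true]
        have hq := (verified_eq_some.1 hv).2
        have := ih (z ++ [Prod.map (φ i) (φ i) q]) fun I z' hI hz' => by
          rw [List.append_assoc]
          refine hF (i :: I) _ (hI.cons_cons i) (List.Forall₂.cons ⟨q.1, q.2, hq.1, ?_, rfl⟩ hz')
          exact add_right_cancel (b := c i) hq.2
        refine le_trans (le_of_eq ?_) this
        rw [List.length_append, List.length_singleton, Nat.cast_add, Nat.cast_one, ha]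
        ring
    refine le_trans ?_ hstep
    rw [outputExp, runExp_linear, ← outputExp, ← outputExp, outputExp_const, ← successProb, ← hs,
      List.map_cons, List.sum_cons, List.length_cons, Nat.cast_add, Nat.cast_one]
    have hsplit : (z.length : ℝ) + (s + (L.map fun i => successProb C fun x => f (φ i x) + c i).sum)
        - μ = a + s := by rw [ha]; ring
    rw [hsplit]
    -- This is the slack in bounding the variance s(1 - s) by 1.
    have : 0 ≤ κ * (1 - s + s ^ 2) := mul_nonneg hκ (by nlinarith)
    nlinarith

end Blocks

end QCircuit

/-! ### Crowded blocks and counting of functions -/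

namespace QCircuit

section Combinatorics

variable {M N n : ℕ} {ι : Type*}

open Classical in
/-- The blocks that contain a collision which meets a collision inside another block. -/
noncomputable def crowdedBlocks [Fintype ι] (φ : ι → Fin n → Fin M) (f : Fin M → Fin N) :
    Finset ι :=
  Finset.univ.filter fun i => ∃ j, j ≠ i ∧ ∃ a b d, a ≠ b ∧ a ≠ d ∧ φ j a = φ i a ∧
    f (φ i a) = f (φ i b) ∧ f (φ i a) = f (φ j d)

open Classical in
-- By `hφ` a shared point has the same position in both blocks, so a collision that meets one from
-- another block makes its own block crowded. Discarding the crowded blocks leaves disjoint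
-- collisions.
lemma foundDisjointCollisions_of_blocks [Fintype ι] (φ : ι → Fin n → Fin M)
    (hφ : ∀ i j a b, φ i a = φ j b → a = b) (f : Fin M → Fin N) {K : ℕ} {I : List ι}
    {z : List (Fin M × Fin M)} (hI : I.Nodup) (hz : List.Forall₂ (BlockCollision φ f) I z)
    (hK : K + (crowdedBlocks φ f).card ≤ I.length) : FoundDisjointCollisions K f z := by
  have hval : ∀ i ∈ I, ∃ p ∈ z, BlockCollision φ f i p := by
    clear hK hI
    induction hz with
    | nil => simp
    | @cons i p I z hip _ ih =>
      intro j hj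
      rcases List.mem_cons.1 hj with rfl | hj
      · exact ⟨p, by simp, hip⟩
      · obtain ⟨q, hq, hjq⟩ := ih j hj
        exact ⟨q, by simp [hq], hjq⟩
  have hcol : ∀ p ∈ z, IsCollision f p := by
    clear hK hI hval
    induction hz with
    | nil => simp
    | @cons i p I z hip _ ih =>
      intro q hq
      rcases List.mem_cons.1 hq with rfl | hq
      · obtain ⟨x, y, hxy, hf, rfl⟩ := hip
        exact ⟨fun h => hxy (hφ i i x y h), hf⟩
      · exact ih q hq
  -- The empty list is treated apart because `choose!` needs a default pair.
  rcases I.eq_nil_or_concat with rfl | ⟨I', i, rfl⟩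
  · exact ⟨hcol, ∅, by simp, by simpa using Nat.le_of_add_right_le hK, by simp⟩
  have hne : Nonempty (Fin M × Fin M) := ⟨(hval i (by simp)).choose⟩
  generalize I'.concat i = I at hI hz hK hval
  choose! P hPz hP using hval
  have hdisj : ∀ i ∈ I, i ∉ crowdedBlocks φ f → ∀ j ∈ I, j ≠ i → DisjointPairs (P i) (P j) := by
    intro i hi hic j hj hji
    obtain ⟨x, y, hxy, hf, hPi⟩ := hP i hi
    obtain ⟨x', y', hxy', hf', hPj⟩ := hP j hj
    have key : ∀ a b d, a ≠ b → a ≠ d → f (φ i a) = f (φ i b) → f (φ j a) = f (φ j d) →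
        φ i a ≠ φ j a := by
      intro a b d hab had h1 h2 h3
      apply hic
      simp only [crowdedBlocks, Finset.mem_filter, Finset.mem_univ, true_and]
      exact ⟨j, hji, a, b, d, hab, had, h3.symm, h1, by rw [h3]; exact h2⟩
    rw [hPi, hPj]
    refine ⟨fun h => ?_, fun h => ?_, fun h => ?_, fun h => ?_⟩
    · have h : φ i x = φ j x' := h
      obtain rfl := hφ _ _ _ _ h
      exact key x y y' hxy hxy' hf hf' h
    · have h : φ i x = φ j y' := h
      obtain rfl := hφ _ _ _ _ h
      exact key x y x' hxy hxy'.symm hf hf'.symm h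
    · have h : φ i y = φ j x' := h
      obtain rfl := hφ _ _ _ _ h
      exact key y x y' hxy.symm hxy' hf.symm hf' h
    · have h : φ i y = φ j y' := h
      obtain rfl := hφ _ _ _ _ h
      exact key y x x' hxy.symm hxy'.symm hf.symm hf'.symm h
  refine ⟨hcol, (I.toFinset \ crowdedBlocks φ f).image P, ?_, ?_, ?_⟩
  · intro p hp
    obtain ⟨i, hi, rfl⟩ := Finset.mem_image.1 hp
    exact hPz i (List.mem_toFinset.1 (Finset.mem_sdiff.1 hi).1)
  · rw [Finset.card_image_of_injOn]
    · have h1 := Finset.le_card_sdiff (crowdedBlocks φ f) I.toFinset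
      rw [List.toFinset_card_of_nodup hI] at h1
      omega
    · intro i hi j hj hij
      by_contra hne
      rw [Finset.mem_coe, Finset.mem_sdiff, List.mem_toFinset] at hi hj
      exact (hdisj i hi.1 hi.2 j hj.1 (Ne.symm hne)).1 (by rw [hij])
  · intro p hp q hq hpq
    obtain ⟨i, hi, rfl⟩ := Finset.mem_image.1 hp
    obtain ⟨j, hj, rfl⟩ := Finset.mem_image.1 hq
    rw [Finset.mem_sdiff, List.mem_toFinset] at hi hj
    exact hdisj i hi.1 hi.2 j hj.1 fun h => hpq (by rw [h])

open Classical in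
-- Overwriting the value at y loses nothing, since it can be recovered from the value at x.
lemma card_collision_mul_le {x y : Fin M} (hxy : x ≠ y) :
    (Finset.univ.filter fun f : Fin M → Fin N => f x = f y).card * N
      ≤ Fintype.card (Fin M → Fin N) := by
  have hN : N = (Finset.univ : Finset (Fin N)).card := by simp
  conv_lhs => arg 2; rw [hN]
  rw [← Finset.card_product, ← Finset.card_univ]
  refine Finset.card_le_card_of_injOn (fun q => Function.update q.1 y q.2) (by simp) ?_
  rintro ⟨f, u⟩ hf ⟨g, v⟩ hg h
  simp only [Finset.coe_product, Set.mem_prod, Finset.mem_coe, Finset.mem_filter,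
    Finset.mem_univ, true_and, and_true] at hf hg h
  have huv : u = v := by simpa using congrFun h y
  have hne : ∀ t, t ≠ y → f t = g t := fun t ht => by simpa [ht] using congrFun h t
  refine Prod.ext ?_ huv
  funext t
  by_cases ht : t = y
  · subst ht
    exact hf.symm.trans ((hne x hxy).trans hg)
  · exact hne t ht

open Classical in
lemma card_triple_collision_mul_le {x y z : Fin M} (hxy : x ≠ y) (hxz : x ≠ z) (hyz : y ≠ z) :
    (Finset.univ.filter fun f : Fin M → Fin N => f x = f y ∧ f x = f z).card * N ^ 2
      ≤ Fintype.card (Fin M → Fin N) := by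
  have hN : N ^ 2 = (Finset.univ : Finset (Fin N × Fin N)).card := by
    rw [Finset.card_univ, Fintype.card_prod, Fintype.card_fin, sq]
  rw [hN, ← Finset.card_product, ← Finset.card_univ]
  refine Finset.card_le_card_of_injOn
    (fun q => Function.update (Function.update q.1 y q.2.1) z q.2.2) (by simp) ?_
  rintro ⟨f, u, u'⟩ hf ⟨g, v, v'⟩ hg h
  simp only [Finset.coe_product, Set.mem_prod, Finset.mem_coe, Finset.mem_filter,
    Finset.mem_univ, true_and, and_true] at hf hg h
  have huv' : u' = v' := by simpa using congrFun h z
  have huv : u = v := by simpa [hyz] using congrFun h y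
  have hne : ∀ t, t ≠ y → t ≠ z → f t = g t := fun t ht ht' => by
    simpa [ht, ht'] using congrFun h t
  refine Prod.ext ?_ (Prod.ext huv huv')
  funext t
  by_cases ht : t = y
  · subst ht
    exact hf.1.symm.trans ((hne x hxy hxz).trans hg.1)
  by_cases ht' : t = z
  · subst ht'
    exact hf.2.symm.trans ((hne x hxy hxz).trans hg.2)
  · exact hne t ht ht'

open Classical in
-- Union bound over the witnesses (i, a, b, j, d), with at most A choices of j. The points φ i a, φ
-- i b, φ j d are distinct, because blocks i and j would otherwise share two points; so each event
-- has probability at most 1/N².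
lemma sum_card_crowdedBlocks_mul_le [Fintype ι] (φ : ι → Fin n → Fin M)
    (hφ : ∀ i j a b, φ i a = φ j b → a = b)
    (hφ2 : ∀ i j a b, i ≠ j → φ i a = φ j a → φ i b = φ j b → a = b) (A : ℕ)
    (hA : ∀ i a, (Finset.univ.filter fun j => φ j a = φ i a).card ≤ A) :
    (∑ f : Fin M → Fin N, (crowdedBlocks φ f).card) * N ^ 2
      ≤ Fintype.card ι * (n * (n * (A * (n * Fintype.card (Fin M → Fin N))))) := by
  have h1 : ∀ f : Fin M → Fin N, (crowdedBlocks φ f).card ≤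
      ∑ i, ∑ a, ∑ b, ∑ j ∈ Finset.univ.filter fun j => φ j a = φ i a, ∑ d,
        if j ≠ i ∧ a ≠ b ∧ a ≠ d ∧ f (φ i a) = f (φ i b) ∧ f (φ i a) = f (φ j d)
          then 1 else 0 := by
    intro f
    rw [crowdedBlocks, Finset.card_filter]
    refine Finset.sum_le_sum fun i _ => ?_
    split_ifs with h
    · obtain ⟨j, hji, a, b, d, hab, had, hj, h1, h2⟩ := h
      refine le_trans ?_ (Finset.single_le_sum (fun _ _ => Nat.zero_le _) (Finset.mem_univ a))
      refine le_trans ?_ (Finset.single_le_sum (fun _ _ => Nat.zero_le _) (Finset.mem_univ b))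
      refine le_trans ?_ (Finset.single_le_sum (fun _ _ => Nat.zero_le _)
        (Finset.mem_filter.2 ⟨Finset.mem_univ j, hj⟩))
      refine le_trans ?_ (Finset.single_le_sum (fun _ _ => Nat.zero_le _) (Finset.mem_univ d))
      rw [if_pos ⟨hji, hab, had, h1, h2⟩]
    · exact Nat.zero_le _
  have h2 : ∀ i a b, ∀ j ∈ Finset.univ.filter (fun j => φ j a = φ i a), ∀ d,
      (∑ f : Fin M → Fin N,
        if j ≠ i ∧ a ≠ b ∧ a ≠ d ∧ f (φ i a) = f (φ i b) ∧ f (φ i a) = f (φ j d)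
          then 1 else 0) * N ^ 2 ≤ Fintype.card (Fin M → Fin N) := by
    intro i a b j hj d
    have hj := (Finset.mem_filter.1 hj).2
    by_cases h : j ≠ i ∧ a ≠ b ∧ a ≠ d
    · obtain ⟨hji, hab, had⟩ := h
      simp only [ne_eq, hji, hab, had, not_false_eq_true, true_and]
      rw [← Finset.card_filter]
      refine card_triple_collision_mul_le (fun h => hab (hφ _ _ _ _ h))
        (fun h => had (hφ _ _ _ _ h)) fun h => ?_
      obtain rfl := hφ _ _ _ _ h
      exact hab (hφ2 i j a b hji.symm hj.symm h)
    · rw [Finset.sum_eq_zero]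
      · simp
      · intro f _
        rw [if_neg]
        tauto
  calc (∑ f : Fin M → Fin N, (crowdedBlocks φ f).card) * N ^ 2
      ≤ (∑ f : Fin M → Fin N,
        ∑ i, ∑ a, ∑ b, ∑ j ∈ Finset.univ.filter fun j => φ j a = φ i a, ∑ d,
        if j ≠ i ∧ a ≠ b ∧ a ≠ d ∧ f (φ i a) = f (φ i b) ∧ f (φ i a) = f (φ j d)
          then 1 else 0) * N ^ 2 := Nat.mul_le_mul_right _ (Finset.sum_le_sum fun f _ => h1 f)
    _ = ∑ i, ∑ a, ∑ b, ∑ j ∈ Finset.univ.filter fun j => φ j a = φ i a, ∑ d,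
        (∑ f : Fin M → Fin N,
          if j ≠ i ∧ a ≠ b ∧ a ≠ d ∧ f (φ i a) = f (φ i b) ∧ f (φ i a) = f (φ j d)
          then 1 else 0) * N ^ 2 := by
        rw [Finset.sum_comm, Finset.sum_mul]
        refine Finset.sum_congr rfl fun i _ => ?_
        rw [Finset.sum_comm, Finset.sum_mul]
        refine Finset.sum_congr rfl fun a _ => ?_
        rw [Finset.sum_comm, Finset.sum_mul]
        refine Finset.sum_congr rfl fun b _ => ?_
        rw [Finset.sum_comm, Finset.sum_mul]
        refine Finset.sum_congr rfl fun j _ => ?_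
        rw [Finset.sum_comm, Finset.sum_mul]
    _ ≤ ∑ i : ι, ∑ a : Fin n, ∑ _b : Fin n, ∑ _j ∈ Finset.univ.filter fun j => φ j a = φ i a,
        ∑ _d : Fin n, Fintype.card (Fin M → Fin N) := by
        gcongr with i _ a _ b _ j hj d _
        exact h2 i a b j hj d
    _ ≤ ∑ _i : ι, ∑ _a : Fin n, ∑ _b : Fin n, A * (n * Fintype.card (Fin M → Fin N)) := by
        gcongr with i _ a _ b _
        rw [Finset.sum_const, Finset.sum_const, smul_eq_mul, smul_eq_mul, Finset.card_univ,
          Fintype.card_fin]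
        exact Nat.mul_le_mul_right _ (hA i a)
    _ = Fintype.card ι * (n * (n * (A * (n * Fintype.card (Fin M → Fin N))))) := by
        simp only [Finset.sum_const, smul_eq_mul, Finset.card_univ, Fintype.card_fin]

end Combinatorics

/-! ### Pairwise independence of the block inputs -/

section Independence

variable {M N n : ℕ} [NeZero N] {ι : Type*} [DecidableEq ι]

/-- Let k be the value of h at the common point, if there is one. Take F = h - k on block i and 0
elsewhere, and compensate by C i = k; then F vanishes on block j as well. -/
lemma exists_shift (φ : ι → Fin n → Fin M) (hφ : ∀ i j a b, φ i a = φ j b → a = b)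
    (hφ2 : ∀ i j a b, i ≠ j → φ i a = φ j a → φ i b = φ j b → a = b) {i j : ι} (hij : i ≠ j)
    (h : Fin n → Fin N) : ∃ F : Fin M → Fin N, ∃ C : ι → Fin N,
      (∀ x, F (φ i x) + C i = h x) ∧ ∀ x, F (φ j x) + C j = 0 := by
  have hinj : Function.Injective (φ i) := fun a b hab => hφ i i a b hab
  obtain ⟨k, hk⟩ : ∃ k, ∀ a, φ i a = φ j a → h a = k := by
    by_cases hex : ∃ a, φ i a = φ j a
    · obtain ⟨a, ha⟩ := hex
      exact ⟨h a, fun b hb => by rw [hφ2 i j a b hij ha hb]⟩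
    · exact ⟨0, fun a ha => absurd ⟨a, ha⟩ hex⟩
  refine ⟨Function.extend (φ i) (fun a => h a - k) 0, Pi.single i k, fun x => ?_, fun x => ?_⟩
  · rw [hinj.extend_apply, Pi.single_eq_same, sub_add_cancel]
  · rw [Pi.single_eq_of_ne hij.symm, add_zero]
    by_cases hex : ∃ a, φ i a = φ j x
    · obtain ⟨a, ha⟩ := hex
      obtain rfl := hφ _ _ _ _ ha
      rw [← ha, hinj.extend_apply, hk a ha, sub_self]
    · rw [Function.extend_apply' _ _ _ hex, Pi.zero_apply]

variable [Fintype ι]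

/-- By `exists_shift`, translating (f, c) moves the input of block i by any h and leaves that of
block j alone. Averaging over h replaces u by its mean, which is zero. -/
lemma sum_mul_blocks_eq_zero (φ : ι → Fin n → Fin M) (hφ : ∀ i j a b, φ i a = φ j b → a = b)
    (hφ2 : ∀ i j a b, i ≠ j → φ i a = φ j a → φ i b = φ j b → a = b) {i j : ι} (hij : i ≠ j)
    (u v : (Fin n → Fin N) → ℝ) (hu : ∑ g, u g = 0) :
    ∑ q : (Fin M → Fin N) × (ι → Fin N),
      u (fun x => q.1 (φ i x) + q.2 i) * v (fun x => q.1 (φ j x) + q.2 j) = 0 := by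
  set S := ∑ q : (Fin M → Fin N) × (ι → Fin N),
      u (fun x => q.1 (φ i x) + q.2 i) * v (fun x => q.1 (φ j x) + q.2 j) with hS
  have h1 : ∀ h : Fin n → Fin N, S = ∑ q : (Fin M → Fin N) × (ι → Fin N),
      u ((fun x => q.1 (φ i x) + q.2 i) + h) * v (fun x => q.1 (φ j x) + q.2 j) := by
    intro h
    obtain ⟨F, C, hi, hj⟩ := exists_shift φ hφ hφ2 hij h
    rw [hS, ← Equiv.sum_comp (Equiv.addRight ((F, C) : (Fin M → Fin N) × (ι → Fin N)))]
    refine Finset.sum_congr rfl fun q _ => ?_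
    congr 2
    · funext x
      simp only [Equiv.coe_addRight, Prod.fst_add, Prod.snd_add, Pi.add_apply, ← hi]
      abel
    · funext x
      simp only [Equiv.coe_addRight, Prod.fst_add, Prod.snd_add, Pi.add_apply]
      rw [add_add_add_comm, hj, add_zero]
  have h2 : ∑ _h : Fin n → Fin N, S = 0 := by
    rw [Finset.sum_congr rfl fun h _ => h1 h, Finset.sum_comm]
    refine Finset.sum_eq_zero fun q _ => ?_
    rw [← Finset.sum_mul]
    have := Equiv.sum_comp (Equiv.addLeft fun x => q.1 (φ i x) + q.2 i) u
    simp only [Equiv.coe_addLeft] at this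
    rw [this, hu, zero_mul]
  rw [Finset.sum_const, nsmul_eq_mul, mul_eq_zero] at h2
  refine h2.resolve_left ?_
  exact Nat.cast_ne_zero.2 (Finset.card_ne_zero.2 Finset.univ_nonempty)

lemma sum_sq_blocks_le (φ : ι → Fin n → Fin M) (hφ : ∀ i j a b, φ i a = φ j b → a = b)
    (hφ2 : ∀ i j a b, i ≠ j → φ i a = φ j a → φ i b = φ j b → a = b)
    (u : (Fin n → Fin N) → ℝ) (hu : ∑ g, u g = 0) (hu1 : ∀ g, u g ^ 2 ≤ 1) :
    ∑ q : (Fin M → Fin N) × (ι → Fin N), (∑ i, u fun x => q.1 (φ i x) + q.2 i) ^ 2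
      ≤ Fintype.card ι * Fintype.card ((Fin M → Fin N) × (ι → Fin N)) := by
  calc ∑ q : (Fin M → Fin N) × (ι → Fin N), (∑ i, u fun x => q.1 (φ i x) + q.2 i) ^ 2
      = ∑ i, ∑ j, ∑ q : (Fin M → Fin N) × (ι → Fin N),
        u (fun x => q.1 (φ i x) + q.2 i) * u (fun x => q.1 (φ j x) + q.2 j) := by
        simp only [sq, Finset.sum_mul_sum]
        rw [Finset.sum_comm]
        exact Finset.sum_congr rfl fun i _ => Finset.sum_comm
    _ = ∑ i, ∑ q : (Fin M → Fin N) × (ι → Fin N), (u fun x => q.1 (φ i x) + q.2 i) ^ 2 := by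
        refine Finset.sum_congr rfl fun i _ => ?_
        rw [Finset.sum_eq_single i]
        · simp only [sq]
        · intro j _ hj
          exact sum_mul_blocks_eq_zero φ hφ hφ2 hj.symm u u hu
        · simp
    _ ≤ ∑ _i : ι, ∑ _q : (Fin M → Fin N) × (ι → Fin N), (1 : ℝ) :=
        Finset.sum_le_sum fun i _ => Finset.sum_le_sum fun q _ => hu1 _
    _ = _ := by simp

end Independence

end QCircuit

namespace QCircuit

/-! ### Success probability on a uniform input, and necessity of queries -/

section Birthday

open Classical in
-- With 1 - x ≤ exp(-x), the fraction of injective maps is at most exp(-(n - 1)/(2n)) ≤ exp(-1/4),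
-- and exp(1/4) ≥ 5/4.
lemma card_injective_le {n : ℕ} (hn : 2 ≤ n) :
    ((Finset.univ.filter fun f : Fin n → Fin (n ^ 2) => Function.Injective f).card : ℝ)
      ≤ 4 / 5 * Fintype.card (Fin n → Fin (n ^ 2)) := by
  have h1 : (Finset.univ.filter fun f : Fin n → Fin (n ^ 2) => Function.Injective f).card
      = (n ^ 2).descFactorial n := by
    rw [← Fintype.card_subtype,
      Fintype.card_congr (Equiv.subtypeInjectiveEquivEmbedding (Fin n) (Fin (n ^ 2))),
      Fintype.card_embedding_eq, Fintype.card_fin, Fintype.card_fin]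
  have hn0 : (0 : ℝ) < n := by positivity
  have hn2 : (2 : ℝ) ≤ n := by exact_mod_cast hn
  have h2 : ∀ i ∈ Finset.range n, ((n ^ 2 - i : ℕ) : ℝ) ≤ (n : ℝ) ^ 2 * Real.exp (-(i / n ^ 2)) := by
    intro i hi
    have hi' : i ≤ n ^ 2 := by nlinarith [Finset.mem_range.1 hi]
    rw [Nat.cast_sub hi', Nat.cast_pow]
    have := Real.add_one_le_exp (-((i : ℝ) / n ^ 2))
    calc (n : ℝ) ^ 2 - i = n ^ 2 * (-((i : ℝ) / n ^ 2) + 1) := by field_simp; ring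
      _ ≤ _ := by gcongr
  have hsum : ∑ i ∈ Finset.range n, (i : ℝ) = n * (n - 1) / 2 := by
    have : ∀ m : ℕ, ∑ i ∈ Finset.range m, (i : ℝ) = m * (m - 1) / 2 := by
      intro m
      induction m with
      | zero => simp
      | succ m ih =>
        rw [Finset.sum_range_succ, ih]
        push_cast
        ring
    exact this n
  have hexp : Real.exp (-(1 / 4)) ≤ 4 / 5 := by
    rw [Real.exp_neg]
    have := Real.add_one_le_exp (1 / 4 : ℝ)
    rw [inv_le_comm₀ (Real.exp_pos _) (by norm_num)]
    linarith
  rw [h1, Nat.descFactorial_eq_prod_range, Nat.cast_prod]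
  calc ∏ i ∈ Finset.range n, ((n ^ 2 - i : ℕ) : ℝ)
      ≤ ∏ i ∈ Finset.range n, ((n : ℝ) ^ 2 * Real.exp (-(i / n ^ 2))) :=
        Finset.prod_le_prod (fun _ _ => Nat.cast_nonneg _) h2
    _ = ((n : ℝ) ^ 2) ^ n * Real.exp (-(n * (n - 1) / 2 / n ^ 2)) := by
        rw [Finset.prod_mul_distrib, Finset.prod_const, Finset.card_range, ← Real.exp_sum,
          Finset.sum_neg_distrib, ← Finset.sum_div, hsum]
    _ ≤ ((n : ℝ) ^ 2) ^ n * Real.exp (-(1 / 4)) := by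
        have : (1 : ℝ) / 4 ≤ n * (n - 1) / 2 / n ^ 2 := by
          rw [div_div, div_le_div_iff₀ (by norm_num) (by positivity)]
          nlinarith
        exact mul_le_mul_of_nonneg_left (Real.exp_le_exp.2 (neg_le_neg this)) (by positivity)
    _ ≤ ((n : ℝ) ^ 2) ^ n * (4 / 5) := by gcongr
    _ = _ := by simp [mul_comm]

lemma sum_successProb_ge {n : ℕ} (hn : 2 ≤ n) (C : QCircuit n (n ^ 2))
    (hC : SolvesElementDistinctness C) :
    2 / 15 * (Fintype.card (Fin n → Fin (n ^ 2)) : ℝ) ≤ ∑ g, successProb C g := by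
  classical
  have h1 := card_injective_le hn
  have h2 := Finset.card_filter_add_card_filter_not (s := (Finset.univ : Finset (Fin n → Fin (n ^ 2))))
    fun f => Function.Injective f
  have h3 : ((Finset.univ.filter fun f : Fin n → Fin (n ^ 2) => Function.Injective f).card : ℝ) +
      (Finset.univ.filter fun f : Fin n → Fin (n ^ 2) => ¬ Function.Injective f).card
      = Fintype.card (Fin n → Fin (n ^ 2)) := by
    rw [← Finset.card_univ]
    exact_mod_cast h2
  have h4 : 2 / 3 * ((Finset.univ.filter fun f : Fin n → Fin (n ^ 2) =>
      ¬ Function.Injective f).card : ℝ) ≤ ∑ g, successProb C g := by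
    refine le_trans ?_ (Finset.sum_le_univ_sum_of_nonneg
      (s := Finset.univ.filter fun f : Fin n → Fin (n ^ 2) => ¬ Function.Injective f)
      (successProb_nonneg C))
    refine le_trans ?_ (Finset.sum_le_sum fun g _ => outputProb_le_successProb C g)
    unfold SolvesElementDistinctness at hC
    convert hC
  linarith

/-- Without queries the distribution of the output does not depend on g, so the sum over g can be
taken inside. -/
lemma sum_runExp_le_of_no_query {n N W : ℕ} (F : (Fin n → Fin N) → List (Fin n × Fin n) → ℝ)
    (B : ℝ) (hF : ∀ y, ∑ g, F g y ≤ B) (gs : List (Gate n N W))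
    (hgs : gs.countP Gate.isQuery = 0) (ψ : MemBasis n N W → ℂ) (y : List (Fin n × Fin n)) :
    ∑ g, runExp g (F g) gs ψ y ≤ B * sqNorm ψ := by
  induction gs generalizing ψ y with
  | nil =>
    simp only [runExp]
    rw [← Finset.sum_mul]
    exact mul_le_mul_of_nonneg_right (hF y) (sqNorm_nonneg ψ)
  | cons G gs ih =>
    cases G with
    | query => simp [Gate.isQuery] at hgs
    | op Q =>
      simp only [runExp]
      rw [Finset.sum_comm, ← sum_sqNorm_mulVec _ Q.complete, Finset.mul_sum]
      refine Finset.sum_le_sum fun i _ => ih ?_ _ _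
      simpa [Gate.isQuery] using hgs

lemma time_pos_of_solves {n : ℕ} (hn : 3 ≤ n) (C : QCircuit n (n ^ 2))
    (hC : SolvesElementDistinctness C) : 0 < C.time := by
  classical
  by_contra h0
  have h0 : C.time = 0 := by omega
  have hn3 : (3 : ℝ) ≤ n := by exact_mod_cast hn
  have hnn : (0 : ℝ) < (n : ℝ) ^ 2 := by positivity
  have : Nonempty (Fin n → Fin (n ^ 2)) := ⟨fun _ => ⟨0, by positivity⟩⟩
  have hcard : (0 : ℝ) < Fintype.card (Fin n → Fin (n ^ 2)) := by
    exact_mod_cast Fintype.card_pos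
  have h1 := sum_successProb_ge (by omega) C hC
  have h2 : ∑ g, successProb C g
      ≤ (Fintype.card (Fin n → Fin (n ^ 2)) : ℝ) / (n : ℝ) ^ 2 := by
    have := sum_runExp_le_of_no_query (fun (g : Fin n → Fin (n ^ 2)) y =>
      if (verified g y.getLast?).isSome then 1 else 0)
      ((Fintype.card (Fin n → Fin (n ^ 2)) : ℝ) / (n : ℝ) ^ 2) (fun y => ?_) C.gates h0
      (Pi.single C.init 1) []
    · rwa [sqNorm_single, mul_one] at this
    · by_cases hy : ∃ q, y.getLast? = some q ∧ q.1 ≠ q.2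
      · obtain ⟨q, hq, hne⟩ := hy
        have hc := card_collision_mul_le (N := n ^ 2) hne
        rw [le_div_iff₀ hnn]
        have hc' : ((Finset.univ.filter fun g : Fin n → Fin (n ^ 2) => g q.1 = g q.2).card : ℝ)
            * (n : ℝ) ^ 2 ≤ Fintype.card (Fin n → Fin (n ^ 2)) := by exact_mod_cast hc
        refine le_trans ?_ hc'
        gcongr
        rw [Finset.card_filter, Nat.cast_sum]
        refine Finset.sum_le_sum fun g _ => ?_
        by_cases hg : g q.1 = g q.2 <;> simp [verified, hq, hne, hg, Option.filter]
      · rw [Finset.sum_eq_zero]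
        · positivity
        · intro g _
          rw [if_neg]
          intro hs
          obtain ⟨q, hq⟩ := Option.isSome_iff_exists.1 hs
          obtain ⟨h1, h2⟩ := verified_eq_some.1 hq
          exact hy ⟨q, h1, h2.1⟩
  -- The success probability would lie between 2/15 and 1/n² ≤ 1/9, which is impossible.
  have h3 := h1.trans h2
  rw [le_div_iff₀ hnn] at h3
  have h4 : (9 : ℝ) ≤ (n : ℝ) ^ 2 := by nlinarith
  nlinarith [mul_le_mul_of_nonneg_left h4 hcard.le]

end Birthday

/-! ### Lines over ℤ/p -/

section Lines

variable {n p A : ℕ}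

/-- The points `(t, α t + β)` of the line `(α, β)` in `[n] × ℤ/p`, as elements of `[10 n²]`. -/
def line (hp : n * p ≤ 10 * n ^ 2) (i : Fin A × Fin p) (t : Fin n) : Fin (10 * n ^ 2) :=
  ⟨t * p + (i.1 * t + i.2) % p, by
    have hr : ((i.1 : ℕ) * t + i.2) % p < p := Nat.mod_lt _ (by have := i.2.2; omega)
    have ht : ((t : ℕ) + 1) * p ≤ n * p := Nat.mul_le_mul_right _ t.2
    rw [add_mul, one_mul] at ht
    omega⟩

lemma line_eq_iff (hp : n * p ≤ 10 * n ^ 2) (i j : Fin A × Fin p) (a b : Fin n) :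
    line hp i a = line hp j b ↔
      a = b ∧ ((i.1 : ℕ) * a + i.2 : ZMod p) = (j.1 : ℕ) * b + j.2 := by
  have hp0 : 0 < p := by have := i.2.2; omega
  have hmod : ((i.1 : ℕ) * a + i.2 : ZMod p) = (j.1 : ℕ) * b + j.2 ↔
      ((i.1 : ℕ) * a + i.2) % p = ((j.1 : ℕ) * b + j.2) % p := by
    rw [← ZMod.natCast_eq_natCast_iff']
    push_cast
    rfl
  rw [hmod]
  have hi : ((i.1 : ℕ) * a + i.2) % p < p := Nat.mod_lt _ hp0
  have hj : ((j.1 : ℕ) * b + j.2) % p < p := Nat.mod_lt _ hp0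
  simp only [line, Fin.mk.injEq]
  constructor
  · intro h
    have hd := congrArg (· / p) h
    simp only [Nat.add_comm _ (_ % p), Nat.add_mul_div_right _ _ hp0,
      Nat.div_eq_of_lt hi, Nat.div_eq_of_lt hj, zero_add] at hd
    refine ⟨Fin.ext hd, ?_⟩
    rw [hd] at h ⊢
    omega
  · rintro ⟨rfl, h⟩
    rw [h]

lemma natCast_zmod_inj {a b : ℕ} (ha : a < p) (hb : b < p) (h : (a : ZMod p) = b) : a = b := by
  rwa [ZMod.natCast_eq_natCast_iff', Nat.mod_eq_of_lt ha, Nat.mod_eq_of_lt hb] at h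

/-- Two common points give (α - α')(a - b) = 0 in a field; `hnp` and `hA` ensure that positions and
slopes are determined by their residues. -/
lemma line_inter [Fact p.Prime] (hp : n * p ≤ 10 * n ^ 2) (hnp : n ≤ p) (hA : A ≤ p)
    (i j : Fin A × Fin p) (a b : Fin n) (hij : i ≠ j) (ha : line hp i a = line hp j a)
    (hb : line hp i b = line hp j b) : a = b := by
  have ha := ((line_eq_iff hp i j a a).1 ha).2
  have hb := ((line_eq_iff hp i j b b).1 hb).2
  by_contra hab
  apply hij
  have h1 : (((i.1 : ℕ) : ZMod p) - (j.1 : ℕ)) * (((a : ℕ) : ZMod p) - (b : ℕ)) = 0 := by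
    linear_combination ha - hb
  have h2 : ((i.1 : ℕ) : ZMod p) = (j.1 : ℕ) := by
    rcases mul_eq_zero.1 h1 with h | h
    · exact sub_eq_zero.1 h
    · exact absurd (Fin.ext (natCast_zmod_inj (a.2.trans_le hnp) (b.2.trans_le hnp)
        (sub_eq_zero.1 h))) hab
  have h3 : ((i.2 : ℕ) : ZMod p) = (j.2 : ℕ) := by
    rw [h2] at ha
    exact add_left_cancel ha
  exact Prod.ext (Fin.ext (natCast_zmod_inj (i.1.2.trans_le hA) (j.1.2.trans_le hA) h2))
    (Fin.ext (natCast_zmod_inj i.2.2 j.2.2 h3))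

open Classical in
lemma card_line_through_le (hp : n * p ≤ 10 * n ^ 2) (i : Fin A × Fin p) (a : Fin n) :
    (Finset.univ.filter fun j : Fin A × Fin p => line hp j a = line hp i a).card ≤ A := by
  conv_rhs => rw [← Fintype.card_fin A, ← Finset.card_univ]
  refine Finset.card_le_card_of_injOn Prod.fst (by simp) ?_
  intro j hj k hk hjk
  simp only [Finset.coe_filter, Finset.mem_univ, true_and, Set.mem_ofPred_eq] at hj hk
  have h := ((line_eq_iff hp j k a a).1 (hj.trans hk.symm)).2
  rw [hjk] at h
  exact Prod.ext hjk (Fin.ext (natCast_zmod_inj j.2.2 k.2.2 (add_left_cancel h)))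

end Lines

/-! ### The combined circuit and its success probability -/

section Combine

variable {M N n : ℕ} [NeZero N] {ι : Type*} [Fintype ι]

/-- The circuit that runs `C` on the inputs `f ∘ φ i + c i` one after the other, and outputs the
collisions that are found. -/
noncomputable def combine (C : QCircuit n N) (φ : ι → Fin n → Fin M) (x₀ : Fin M)
    (c : ι → Fin N) : QCircuit M N where
  W := Fintype.card (Fin n × Fin C.W × Option (Fin n × Fin n))
  init := (x₀, C.init.2.1, Fintype.equivFin _ (C.init.1, C.init.2.2, none))
  gates := Finset.univ.toList.flatMap fun i => block C (φ i) (Fintype.equivFin _) (c i)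

lemma time_combine (C : QCircuit n N) (φ : ι → Fin n → Fin M) (x₀ : Fin M) (c : ι → Fin N) :
    (combine C φ x₀ c).time = Fintype.card ι * (C.time + 2) := by
  rw [time, combine, List.countP_flatMap]
  simp only [Function.comp_def, countP_block]
  simp

lemma outputProb_combine_nonneg (C : QCircuit n N) (φ : ι → Fin n → Fin M) (x₀ : Fin M)
    (c : ι → Fin N) (f : Fin M → Fin N) (accept : List (Fin M × Fin M) → Prop) :
    0 ≤ (combine C φ x₀ c).outputProb f accept := by
  classical
  rw [outputProb, runProb_eq_runExp]
  calc (0 : ℝ) = runExp f (fun _ => 0) (combine C φ x₀ c).gates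
        (Pi.single (combine C φ x₀ c).init 1) [] := by rw [runExp_const, zero_mul]
    _ ≤ _ := runExp_mono f (fun z => by split_ifs <;> simp) _ _ _

/-- For X output pairs, 1 - (X - μ)²/d² is at most the indicator of acceptance: a rejected run has X
< K + β ≤ μ - d. -/
lemma le_outputProb_combine (C : QCircuit n N) (φ : ι → Fin n → Fin M)
    (hφ : ∀ i j a b, φ i a = φ j b → a = b) (x₀ : Fin M) (c : ι → Fin N) (f : Fin M → Fin N)
    (K : ℕ) (μ β d : ℝ) (hd : 0 < d) (hμ : K + β + d ≤ μ)
    (hβ : ((crowdedBlocks φ f).card : ℝ) ≤ β) :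
    1 - (d ^ 2)⁻¹ * ((∑ i, successProb C (fun x => f (φ i x) + c i) - μ) ^ 2 + Fintype.card ι)
      ≤ (combine C φ x₀ c).outputProb f (FoundDisjointCollisions K f) := by
  classical
  rw [outputProb, runProb_eq_runExp]
  have hrun : ∀ (F : List (Fin M × Fin M) → ℝ)
      (b : MemBasis M N (Fintype.card (Fin n × Fin C.W × Option (Fin n × Fin n)))),
      runExp f F (Finset.univ.toList.flatMap fun i => block C (φ i) (Fintype.equivFin _) (c i))
        (Pi.single b 1) [] = blocksExp C φ c f F Finset.univ.toList [] := fun F b => by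
    rw [runExp_blocks, sqNorm_single, mul_one]
  refine le_trans ?_ (hrun _ (combine C φ x₀ c).init).ge
  refine le_trans (le_of_eq ?_) (le_blocksExp C φ c f _ μ (d ^ 2)⁻¹ (by positivity) _ []
    fun I z' hI hz' => ?_)
  · simp [Finset.sum_map_toList]
  · rw [List.nil_append]
    split_ifs with h
    · have : 0 ≤ (d ^ 2)⁻¹ * ((z'.length : ℝ) - μ) ^ 2 := by positivity
      linarith
    · have hlt : I.length < K + (crowdedBlocks φ f).card := by
        by_contra hle
        exact h (foundDisjointCollisions_of_blocks φ hφ f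
          (hI.nodup (Finset.nodup_toList _)) hz' (not_lt.1 hle))
      rw [hz'.length_eq] at hlt
      have hlt' : (z'.length : ℝ) < K + (crowdedBlocks φ f).card := by exact_mod_cast hlt
      have h1 : d ^ 2 ≤ ((z'.length : ℝ) - μ) ^ 2 := by nlinarith
      have h2 : 1 ≤ (d ^ 2)⁻¹ * ((z'.length : ℝ) - μ) ^ 2 := by
        rw [inv_mul_eq_div, le_div_iff₀ (by positivity)]
        linarith
      linarith

open Classical in
lemma exists_combine_finds (C : QCircuit n N) (φ : ι → Fin n → Fin M)
    (hφ : ∀ i j a b, φ i a = φ j b → a = b)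
    (hφ2 : ∀ i j a b, i ≠ j → φ i a = φ j a → φ i b = φ j b → a = b) (A : ℕ)
    (hA : ∀ i a, (Finset.univ.filter fun j => φ j a = φ i a).card ≤ A) (x₀ : Fin M)
    (K : ℕ) (q β d : ℝ) (hd : 0 < d) (hβ : 0 < β)
    (hq : q * (Fintype.card (Fin n → Fin N) : ℝ) ≤ ∑ g, successProb C g)
    (hK : K + β + d ≤ Fintype.card ι * q)
    (hnum : 2 * (Fintype.card ι / d ^ 2) + Fintype.card ι * A * n ^ 3 / N ^ 2 / β ≤ 1 / 3) :
    ∃ c, FindsDisjointCollisions (combine C φ x₀ c) K := by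
  set m : ℝ := (Fintype.card ι : ℝ) with hm
  set s := successProb C with hs
  have hG0 : (0 : ℝ) < Fintype.card (Fin n → Fin N) := by exact_mod_cast Fintype.card_pos
  have hF0 : (0 : ℝ) < Fintype.card (Fin M → Fin N) := by exact_mod_cast Fintype.card_pos
  have hC0 : (0 : ℝ) < Fintype.card (ι → Fin N) := by exact_mod_cast Fintype.card_pos
  have hN0 : (0 : ℝ) < N := Nat.cast_pos.2 (Nat.pos_of_neZero N)
  set r : ℝ := (∑ g, s g) / Fintype.card (Fin n → Fin N) with hr
  have hqr : q ≤ r := by rwa [hr, le_div_iff₀ hG0]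
  have hrs : ∑ g, (s g - r) = 0 := by
    rw [Finset.sum_sub_distrib, Finset.sum_const, nsmul_eq_mul, Finset.card_univ, hr]
    field_simp
    ring
  have hr0 : 0 ≤ r := div_nonneg (Finset.sum_nonneg fun g _ => successProb_nonneg C g) hG0.le
  have hr1 : r ≤ 1 := by
    rw [hr, div_le_one hG0]
    refine (Finset.sum_le_sum fun g _ => successProb_le_one C g).trans ?_
    simp
  have hu1 : ∀ g, (s g - r) ^ 2 ≤ 1 := fun g => by
    have h0 : 0 ≤ s g := successProb_nonneg C g
    have h1 : s g ≤ 1 := successProb_le_one C g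
    rw [sq_le_one_iff_abs_le_one, abs_le]
    constructor <;> linarith
  have hμ : K + β + d ≤ m * r :=
    hK.trans (mul_le_mul_of_nonneg_left hqr (Nat.cast_nonneg _))
  -- Markov's inequality in pointwise form: if more than β blocks are crowded, the left side is at
  -- most 0.
  have hlow : ∀ (f : Fin M → Fin N) (c : ι → Fin N),
      1 - (d ^ 2)⁻¹ * ((∑ i, (s (fun x => f (φ i x) + c i) - r)) ^ 2 + m)
        - (crowdedBlocks φ f).card / β
      ≤ (combine C φ x₀ c).outputProb f (FoundDisjointCollisions K f) := by
    intro f c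
    by_cases hf : ((crowdedBlocks φ f).card : ℝ) ≤ β
    · refine le_trans ?_ (le_outputProb_combine C φ hφ x₀ c f K (m * r) β d hd hμ hf)
      have : 0 ≤ ((crowdedBlocks φ f).card : ℝ) / β := by positivity
      rw [Finset.sum_sub_distrib, Finset.sum_const, nsmul_eq_mul, Finset.card_univ, ← hm]
      linarith
    · refine le_trans ?_ (outputProb_combine_nonneg C φ x₀ c f _)
      have h1 : 1 ≤ ((crowdedBlocks φ f).card : ℝ) / β := by
        rw [le_div_iff₀ hβ]
        linarith
      have h2 : 0 ≤ (d ^ 2)⁻¹ * ((∑ i, (s (fun x => f (φ i x) + c i) - r)) ^ 2 + m) := by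
        positivity
      linarith
  have hvar := sum_sq_blocks_le φ hφ hφ2 (fun g => s g - r) hrs hu1
  rw [Fintype.sum_prod_type_right, Fintype.card_prod, Nat.cast_mul, ← hm] at hvar
  have hcrowd : ∑ f : Fin M → Fin N, ((crowdedBlocks φ f).card : ℝ)
      ≤ m * A * n ^ 3 / N ^ 2 * Fintype.card (Fin M → Fin N) := by
    have h1 := sum_card_crowdedBlocks_mul_le (N := N) φ hφ hφ2 A hA
    have h2 : (∑ f : Fin M → Fin N, ((crowdedBlocks φ f).card : ℝ)) * N ^ 2
        ≤ m * (n * (n * (A * (n * Fintype.card (Fin M → Fin N))))) := by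
      rw [hm]
      exact_mod_cast h1
    rw [div_mul_eq_mul_div, le_div_iff₀ (by positivity)]
    refine h2.trans (le_of_eq ?_)
    ring
  have htotal : ∑ _c : ι → Fin N, 2 / 3 * (Fintype.card (Fin M → Fin N) : ℝ) ≤
      ∑ c : ι → Fin N, ∑ f : Fin M → Fin N,
        (combine C φ x₀ c).outputProb f (FoundDisjointCollisions K f) := by
    refine le_trans ?_ (Finset.sum_le_sum fun c _ => Finset.sum_le_sum fun f _ => hlow f c)
    simp only [Finset.sum_sub_distrib, Finset.sum_const, nsmul_eq_mul, Finset.card_univ,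
      ← Finset.mul_sum, Finset.sum_add_distrib, ← Finset.sum_div, mul_one]
    have hdd : (0 : ℝ) ≤ (d ^ 2)⁻¹ := by positivity
    have h1 := mul_le_mul_of_nonneg_left hvar hdd
    have h2 := mul_le_mul_of_nonneg_left (div_le_div_of_nonneg_right hcrowd hβ.le) hC0.le
    have h3 := mul_le_mul_of_nonneg_right hnum (mul_pos hC0 hF0).le
    simp only [Finset.sum_sub_distrib, Finset.sum_const, nsmul_eq_mul, Finset.card_univ] at h1 h2 h3 ⊢
    have e1 : m / d ^ 2 = (d ^ 2)⁻¹ * m := by rw [inv_mul_eq_div]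
    have e2 : m * A * n ^ 3 / N ^ 2 * Fintype.card (Fin M → Fin N) / β
        = m * A * n ^ 3 / N ^ 2 / β * Fintype.card (Fin M → Fin N) := by ring
    rw [e1] at h3
    rw [e2] at h2
    linarith
  -- Some shift does at least as well as the average, so the circuit needs no randomness for c.
  obtain ⟨c, -, hc⟩ := Finset.exists_le_of_sum_le Finset.univ_nonempty htotal
  refine ⟨c, ?_⟩
  rw [FindsDisjointCollisions, le_div_iff₀ hF0]
  exact hc

end Combine

end QCircuit

/-! ### Choice of parameters and the final accounting -/

namespace QCircuit

lemma clog_pow_le (x k : ℕ) : Nat.clog 2 (x ^ k) ≤ k * Nat.clog 2 x := by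
  apply Nat.clog_le_of_le_pow
  rw [mul_comm, pow_mul]
  exact Nat.pow_le_pow_left (Nat.le_pow_clog one_lt_two x) k

lemma space_combine_le {n : ℕ} [NeZero (n ^ 2)] {ι : Type*} [Fintype ι] (hn : 2 ≤ n)
    (C : QCircuit n (n ^ 2)) (φ : ι → Fin n → Fin (10 * n ^ 2)) (x₀ : Fin (10 * n ^ 2))
    (c : ι → Fin (n ^ 2)) : (combine C φ x₀ c).space ≤ 4 * C.space := by
  have hW : 0 < C.W := by have := C.init.2.2.2; omega
  refine le_trans (Nat.clog_mono_right 2 ?_) (clog_pow_le (n * n ^ 2 * C.W) 4)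
  have hcard : (combine C φ x₀ c).W = n * (C.W * (n * n + 1)) := by simp [combine]
  rw [hcard]
  have h5 : 20 ≤ n ^ 5 := le_trans (by norm_num) (Nat.pow_le_pow_left hn 5)
  have hW4 : C.W ≤ C.W ^ 4 := Nat.le_self_pow (by norm_num) _
  have h1 : n * n + 1 ≤ 2 * n ^ 2 := by nlinarith
  calc 10 * n ^ 2 * n ^ 2 * (n * (C.W * (n * n + 1)))
      ≤ 10 * n ^ 2 * n ^ 2 * (n * (C.W * (2 * n ^ 2))) := by gcongr
    _ = 20 * n ^ 7 * C.W := by ring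
    _ ≤ n ^ 5 * n ^ 7 * C.W ^ 4 := by gcongr
    _ = (n * n ^ 2 * C.W) ^ 4 := by ring

/-- An algorithm for Element Distinctness on domain size `n` yields an algorithm that finds
`Ω(n²)` disjoint collisions in a random function `f : [10 n²] → [n²]`. -/
lemma exists_findsDisjointCollisions {n : ℕ} (hn : 3000 ≤ n) (C : QCircuit n (n ^ 2))
    (hC : SolvesElementDistinctness C) :
    ∃ (K : ℕ) (D : QCircuit (10 * n ^ 2) (n ^ 2)), (n : ℝ) ^ 2 / 120000 ≤ K ∧
      D.time ≤ n ^ 2 * (C.time + 2) ∧ D.space ≤ 4 * C.space ∧ FindsDisjointCollisions D K := by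
  classical
  have : NeZero (n ^ 2) := ⟨by positivity⟩
  obtain ⟨p, hp, hnp, hp2⟩ := Nat.exists_prime_lt_and_le_two_mul n (by omega)
  have : Fact p.Prime := ⟨hp⟩
  -- Few slopes keep crowded lines rare (expected number at most mA/n), while m = Ap remains of
  -- order n².
  set A := n / 1000 with hA
  have hA1 : 1000 * A ≤ n := Nat.mul_div_le n 1000
  have hA2 : n ≤ 2000 * A := by omega
  have hnp10 : n * p ≤ 10 * n ^ 2 := by nlinarith
  have hm1 : A * p ≤ n ^ 2 := by nlinarith
  have hnR : (3000 : ℝ) ≤ n := by exact_mod_cast hn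
  have hA1R : 1000 * (A : ℝ) ≤ n := by exact_mod_cast hA1
  have hA2R : (n : ℝ) ≤ 2000 * A := by exact_mod_cast hA2
  have hnpR : (n : ℝ) ≤ p := by exact_mod_cast hnp.le
  set m : ℝ := (A : ℝ) * p with hm
  have hm2 : (n : ℝ) ^ 2 / 2000 ≤ m := by
    rw [hm]
    nlinarith
  have hm3 : (4500 : ℝ) ≤ m := le_trans (by nlinarith) hm2
  have hcard : (Fintype.card (Fin A × Fin p) : ℝ) = m := by
    rw [Fintype.card_prod, Fintype.card_fin, Fintype.card_fin, Nat.cast_mul]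
  have hK := Nat.floor_le (show 0 ≤ m / 30 by positivity)
  have hK' := Nat.lt_floor_add_one (m / 30)
  have hnum : 2 * (m / (m / 15) ^ 2) + m * A * n ^ 3 / ((n ^ 2 : ℕ) : ℝ) ^ 2 / (m / 30)
      ≤ 1 / 3 := by
    have hm0 : 0 < m := by linarith
    have hn0 : (0 : ℝ) < n := by linarith
    have e1 : 2 * (m / (m / 15) ^ 2) = 450 / m := by field_simp; norm_num
    have e2 : m * A * n ^ 3 / ((n ^ 2 : ℕ) : ℝ) ^ 2 / (m / 30) = 30 * A / n := by
      push_cast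
      field_simp
    have h1 : 450 / m ≤ 1 / 10 := by
      rw [div_le_div_iff₀ hm0 (by norm_num)]
      linarith
    have h2 : 30 * A / n ≤ (1 : ℝ) / 10 := by
      rw [div_le_div_iff₀ hn0 (by norm_num)]
      linarith
    rw [e1, e2]
    linarith
  have hx : 0 < 10 * n ^ 2 := by positivity
  -- The mean 2m/15 is split into K ≤ m/30, β = m/30 and d = m/15. In `hnum`, one term m/d² comes
  -- from the random inputs and one from the measurements.
  obtain ⟨c, hc⟩ := exists_combine_finds C (line (A := A) hnp10)
    (fun i j a b h => ((line_eq_iff hnp10 i j a b).1 h).1)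
    (fun i j a b hij ha hb => line_inter hnp10 hnp.le (by omega) i j a b hij ha hb) A
    (card_line_through_le hnp10) ⟨0, hx⟩ ⌊m / 30⌋₊ (2 / 15) (m / 30) (m / 15)
    (by positivity) (by positivity) (sum_successProb_ge (by omega) C hC)
    (by rw [hcard]; linarith) (by rw [hcard]; exact hnum)
  refine ⟨_, _, ?_, ?_, space_combine_le (by omega) C _ _ c, hc⟩
  · linarith
  · rw [time_combine, Fintype.card_prod, Fintype.card_fin, Fintype.card_fin]
    exact Nat.mul_le_mul_right _ hm1

end QCircuit

lemma spaceWithin_of_le {a : ℝ} (ha : 0 ≤ a) {l n S S' : ℕ} (hn : 1 ≤ n) {τ : ℝ≥0∞}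
    (hS' : S' ≤ 4 * S) (hS : SpaceWithin a l n τ S) : SpaceWithin (4 * a) l (n ^ 2) τ S' := by
  unfold SpaceWithin at *
  have hn1 : (1 : ℝ) ≤ n := by exact_mod_cast hn
  have hlog : Real.log n ≤ Real.log ((n ^ 2 : ℕ) : ℝ) := by
    apply Real.log_le_log (by linarith)
    push_cast
    nlinarith
  have hlog0 : 0 ≤ Real.log n := Real.log_nonneg hn1
  calc (S' : ℝ≥0∞) ≤ ((4 * S : ℕ) : ℝ≥0∞) := by exact_mod_cast hS'
    _ = ENNReal.ofReal 4 * S := by push_cast; simp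
    _ ≤ ENNReal.ofReal 4 * (ENNReal.ofReal (a * Real.log n ^ l) * τ) := by gcongr
    _ = ENNReal.ofReal (4 * a * Real.log n ^ l) * τ := by
        rw [← mul_assoc, ← ENNReal.ofReal_mul (by norm_num), ← mul_assoc]
    _ ≤ _ := by gcongr

/-- The case `σ = ⊤` (no restriction on the space on either side) is included. -/
theorem corollary6p5 (ε : ℝ) (hε_pos : 0 < ε) (hε_lt : ε < 1) (σ : ℕ → ℝ≥0∞)
    (h : CollisionTradeoff ε σ) :
    ElementDistinctnessTradeoff ε (fun n => σ (n ^ 2)) := by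
  intro a ha l
  obtain ⟨c, hc, k, N₀, hmain⟩ := h (1 / 120000) (by norm_num) 0 (4 * a) (by positivity) l
  -- The 12 combines T + 2 ≤ 3T with the factor 4 that bounds 4^(1/3); 2^k comes from log(n²) = 2
  -- log n.
  refine ⟨c / (12 * 2 ^ k), by positivity, k, max 3000 N₀, fun n hn C hS hC => ?_⟩
  have hn1 : 3000 ≤ n := le_trans (le_max_left _ _) hn
  have hn2 : N₀ ≤ n ^ 2 := le_trans (le_trans (le_max_right _ _) hn) (Nat.le_self_pow two_ne_zero n)
  obtain ⟨K, D, hK, htime, hspace, hD⟩ := QCircuit.exists_findsDisjointCollisions hn1 C hC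
  have hfin := hmain (n ^ 2) hn2 K (by rw [pow_zero, div_one]; push_cast; linarith) D
    (spaceWithin_of_le ha.le (by omega) hspace hS) hD
  have hn0 : (0 : ℝ) < n := by positivity
  have hT : 1 ≤ C.time := QCircuit.time_pos_of_solves (by omega) C hC
  have htime' : (D.time : ℝ) ≤ n ^ 2 * (3 * C.time) := by
    have : D.time ≤ n ^ 2 * (3 * C.time) :=
      htime.trans (Nat.mul_le_mul_left _ (by omega))
    exact_mod_cast this
  have hspace' : (D.space : ℝ) ^ (1 / 3 : ℝ) ≤ 4 * (C.space : ℝ) ^ (1 / 3 : ℝ) := by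
    have h1 : (D.space : ℝ) ≤ 4 * C.space := by exact_mod_cast hspace
    calc (D.space : ℝ) ^ (1 / 3 : ℝ) ≤ (4 * C.space : ℝ) ^ (1 / 3 : ℝ) :=
          Real.rpow_le_rpow (Nat.cast_nonneg _) h1 (by norm_num)
      _ = 4 ^ (1 / 3 : ℝ) * (C.space : ℝ) ^ (1 / 3 : ℝ) :=
          Real.mul_rpow (by norm_num) (Nat.cast_nonneg _)
      _ ≤ 4 * (C.space : ℝ) ^ (1 / 3 : ℝ) := by
          gcongr
          exact Real.rpow_le_self_of_one_le (by norm_num) (by norm_num)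
  have hpow : ((n ^ 2 : ℕ) : ℝ) ^ (4 / 3 + ε) = (n : ℝ) ^ 2 * (n : ℝ) ^ (2 / 3 + 2 * ε) := by
    rw [Nat.cast_pow, ← Real.rpow_natCast, ← Real.rpow_mul hn0.le, ← Real.rpow_add hn0]
    congr 1
    push_cast
    ring
  have hlog : Real.log ((n ^ 2 : ℕ) : ℝ) = 2 * Real.log n := by
    rw [Nat.cast_pow, Real.log_pow]
    norm_num
  rw [hpow, hlog, mul_pow] at hfin
  have h2 : c * ((n : ℝ) ^ 2 * (n : ℝ) ^ (2 / 3 + 2 * ε)) / (2 ^ k * Real.log n ^ k)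
      ≤ n ^ 2 * (3 * C.time) * (4 * (C.space : ℝ) ^ (1 / 3 : ℝ)) :=
    hfin.trans (by gcongr)
  have hlog0 : 0 < Real.log n := Real.log_pos (by exact_mod_cast (by omega : 1 < n))
  have e : c * ((n : ℝ) ^ 2 * (n : ℝ) ^ (2 / 3 + 2 * ε)) / (2 ^ k * Real.log n ^ k)
      = 12 * n ^ 2 * (c / (12 * 2 ^ k) * (n : ℝ) ^ (2 / 3 + 2 * ε) / Real.log n ^ k) := by
    field_simp
  rw [e] at h2
  have hpos : (0 : ℝ) < 12 * n ^ 2 := by positivity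
  refine le_of_mul_le_mul_left (h2.trans (le_of_eq ?_)) hpos
  ring
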